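/- **Model.** Let $Y=\sum_{m=1}^M \alpha_m\, b(\theta_m)a^H(\theta_m)X+N\in\mathbb C^{N_r\times L}$, where $X\in\mathbb C^{N_t\times L}$ is a known probing signal with sample covariance $R_X=\frac1L XX^H$, the steering vectors $a:\mathbb R\to\mathbb C^{N_t}$ and $b:\mathbb R\to\mathbb C^{N_r}$ are differentiable, and $N$ has i.i.d. $\mathcal{CN}(0,\sigma^2)$ entries, $\sigma^2>0$. The angles $\theta=(\theta_1,\dots,\theta_M)$ have a joint density $p_\Theta\ge 0$ that is differentiable on $\mathbb R^M$. The reflection coefficients $\alpha_m\sim\mathcal{CN}(0,2\sigma_{\alpha_m}^2)$, $\sigma_{\alpha_m}>0$, are independent of each other and of $\theta$, and $N$ is independent of $(\theta,\alpha)$. Put $M(t)=b(t)a^H(t)$, and let $\dot M$ be its derivative. Assume that $\mathbb E\|M(\theta_m)\|^2$, $\mathbb E\|\dot M(\theta_m)\|^2$ and $\mathbb E[(\partial_{\theta_m}\ln p_\Theta(\theta))^2]$ are finite for every $m$. Let $\zeta\in\mathbb R^{3M}$ consist of the angles $\theta_m$ and of the real and imaginary parts of the $\alpha_m$. Let $p_Z$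 be the density of $\zeta$, and let $f(Y|\zeta)=\prod_{i,l}\frac1{\pi\sigma^2}e^{-|Y_{il}-\mu_{il}(\zeta)|^2/\sigma^2}$ with $\mu(\zeta)=\sum_m\alpha_mM(\theta_m)X$. Define $$F=\mathbb E\big[\nabla_\zeta\ln (f(Y|\zeta)p_Z(\zeta))\,\nabla_\zeta\ln (f(Y|\zeta)p_Z(\zeta))^T\big],$$ $$F_O=\mathbb E\big[\nabla_\zeta\ln f(Y|\zeta)\,\nabla_\zeta\ln f(Y|\zeta)^T\big],\qquad F_P=\mathbb E\big[\nabla_\zeta\ln p_Z(\zeta)\,\nabla_\zeta\ln p_Z(\zeta)^T\big],$$ $$\beta_m=\frac{4L\sigma_{\alpha_m}^2}{\sigma^2},\qquad A_m=\mathbb E[\dot M^H(\theta_m)\dot M(\theta_m)],\qquad \delta_m=[F_P]_{m,m}.$$ **Claim.** 1. The pair $(\zeta,Y)$ has joint density $f(Y|\zeta)p_Z(\zeta)$. The components of $\nabla_\zeta \ln f(Y|\zeta)$ and $\nabla_\zeta\ln p_Z(\zeta)$ are square integrable. Moreover $F=F_O+F_P$, and $F$ is positive definite. 2. The $\theta$-$\theta$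 block of $F_O$ is diagonal with $m$-th diagonal entry $\beta_m\mathrm{tr}(A_mR_X)$, and the $\theta$-$\alpha$ block of $F_O$ is zero. 3. For every measurable estimator $\hat\zeta(Y)$ whose error components are square integrable, $\mathbb E[(\hat\zeta(Y)-\zeta)(\hat\zeta(Y)-\zeta)^T]\succeq F^{-1}$. 4. For every $m$, $\beta_m\mathrm{tr}(A_mR_X)+\delta_m>0$, and every measurable estimator $\hat\theta_m(Y)$ satisfies $$\mathbb E[(\hat\theta_m(Y)-\theta_m)^2]\ \ge\ [F^{-1}]_{m,m}\qquad\text{and}\qquad \mathbb E[(\hat\theta_m(Y)-\theta_m)^2]\ \ge\ \big(\beta_m\mathrm{tr}(A_mR_X)+\delta_m\big)^{-1},$$ where the left-hand side may be $+\infty$. 5. If moreover $\theta_1,\dots,\theta_M$ are independent, then $F_P$ is diagonal and, for every $m$, $$\mathrm{PCRB}_{\theta_m}:=[F^{-1}]_{m,m}=\big(\beta_m\mathrm{tr}(A_mR_X)+\delta_m\big)^{-1}.$$ -/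

import Mathlib

open MeasureTheory ProbabilityTheory
open scoped Matrix ENNReal

/-- The circularly symmetric complex Gaussian law `CN(0, v)` (for `0 < v`), given by its density
`(π v)⁻¹ exp (-|z|² / v)` with respect to Lebesgue measure on `ℂ`. -/
noncomputable def cscg (v : ℝ) : Measure ℂ :=
  volume.withDensity fun z => ENNReal.ofReal ((Real.pi * v)⁻¹ * Real.exp (-‖z‖ ^ 2 / v))

/-- Index set of the `3M` real parameters: `Sum.inl m` is the angle `θ_m`, `Sum.inr (m, 0)` and
`Sum.inr (m, 1)` are the real and the imaginary part of the reflection coefficient `α_m`. -/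
abbrev ParamIdx (M : ℕ) : Type := Fin M ⊕ (Fin M × Fin 2)

/-- The received signal collected over the `L` samples, entry by entry
(receive antenna, then sample). -/
abbrev Obs (Nr L : ℕ) : Type := Fin Nr → Fin L → ℂ

/-- The data of a multi-target MIMO sensing system: `M` targets, `Nt` transmit and `Nr` receive
antennas, `L` samples. -/
structure SensingSystem (M Nt Nr L : ℕ) where
  /-- transmit steering vector `a(θ)` -/
  a : ℝ → Fin Nt → ℂ
  /-- receive steering vector `b(θ)` -/
  b : ℝ → Fin Nr → ℂ
  /-- probing signals, one column for each sample -/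
  X : Matrix (Fin Nt) (Fin L) ℂ
  /-- noise power `σ²` -/
  noiseVar : ℝ
  /-- `σ_{α_m}`, so that `α_m ~ CN(0, 2 σ_{α_m}²)` -/
  sigmaAlpha : Fin M → ℝ
  /-- joint density of the angles -/
  prior : (Fin M → ℝ) → ℝ

namespace SensingSystem

variable {M Nt Nr L : ℕ}

/-- `R_X = (1 / L) X Xᴴ`. -/
noncomputable def RX (S : SensingSystem M Nt Nr L) : Matrix (Fin Nt) (Fin Nt) ℂ :=
  ((L : ℂ)⁻¹) • (S.X * S.Xᴴ)

/-- `M(t) = b(t) aᴴ(t)`. -/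
noncomputable def resp (S : SensingSystem M Nt Nr L) (t : ℝ) : Matrix (Fin Nr) (Fin Nt) ℂ :=
  Matrix.vecMulVec (S.b t) (star (S.a t))

/-- The entrywise derivative of `M(t)`. -/
noncomputable def respDeriv (S : SensingSystem M Nt Nr L) (t : ℝ) :
    Matrix (Fin Nr) (Fin Nt) ℂ :=
  Matrix.of fun i k => deriv (fun s => S.resp s i k) t

/-- The real parameter vector `ζ` built from the angles and the reflection coefficients. -/
noncomputable def pack (θ : Fin M → ℝ) (α : Fin M → ℂ) : ParamIdx M → ℝ :=
  Sum.elim θ fun q => if q.2 = 0 then (α q.1).re else (α q.1).im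

/-- The angles in a parameter vector. -/
def angles (ζ : ParamIdx M → ℝ) : Fin M → ℝ := fun m => ζ (Sum.inl m)

/-- The reflection coefficients in a parameter vector. -/
def coeffs (ζ : ParamIdx M → ℝ) : Fin M → ℂ :=
  fun m => ⟨ζ (Sum.inr (m, 0)), ζ (Sum.inr (m, 1))⟩

/-- The noiseless echo `∑ m, α_m b(θ_m) aᴴ(θ_m) X`. -/
noncomputable def echo (S : SensingSystem M Nt Nr L) (θ : Fin M → ℝ) (α : Fin M → ℂ) :
    Matrix (Fin Nr) (Fin L) ℂ :=
  ∑ m, (α m • S.resp (θ m)) * S.X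

/-- The received signal: echo plus noise. -/
noncomputable def received (S : SensingSystem M Nt Nr L) (θ : Fin M → ℝ) (α : Fin M → ℂ)
    (n : Obs Nr L) : Obs Nr L :=
  fun i l => S.echo θ α i l + n i l

/-- The conditional density `f(Y | ζ)`. -/
noncomputable def condPDF (S : SensingSystem M Nt Nr L) (y : Obs Nr L) (ζ : ParamIdx M → ℝ) : ℝ :=
  ∏ i, ∏ l, (Real.pi * S.noiseVar)⁻¹ *
    Real.exp (-‖y i l - S.echo (angles ζ) (coeffs ζ) i l‖ ^ 2 / S.noiseVar)

/-- The centred Gaussian density of the real and of the imaginary part of `α_m`. -/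
noncomputable def alphaPDF (S : SensingSystem M Nt Nr L) (m : Fin M) (x : ℝ) : ℝ :=
  Real.exp (-x ^ 2 / (2 * S.sigmaAlpha m ^ 2)) / (√(2 * Real.pi) * S.sigmaAlpha m)

/-- The prior density `p_Z(ζ)` of all parameters. -/
noncomputable def paramPDF (S : SensingSystem M Nt Nr L) (ζ : ParamIdx M → ℝ) : ℝ :=
  S.prior (angles ζ) *
    ∏ m, S.alphaPDF m (ζ (Sum.inr (m, 0))) * S.alphaPDF m (ζ (Sum.inr (m, 1)))

/-- `∂ ln f(y | ζ) / ∂ ζ_i`. -/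
noncomputable def obsScore (S : SensingSystem M Nt Nr L) (i : ParamIdx M) (y : Obs Nr L)
    (ζ : ParamIdx M → ℝ) : ℝ :=
  lineDeriv ℝ (fun z => Real.log (S.condPDF y z)) ζ (Pi.single i 1)

/-- `∂ ln p_Z(ζ) / ∂ ζ_i`. -/
noncomputable def priorScore (S : SensingSystem M Nt Nr L) (i : ParamIdx M)
    (ζ : ParamIdx M → ℝ) : ℝ :=
  lineDeriv ℝ (fun z => Real.log (S.paramPDF z)) ζ (Pi.single i 1)

/-- `∂ ln (f(y | ζ) p_Z(ζ)) / ∂ ζ_i`: the score of the joint density of `Y` and `ζ`. -/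
noncomputable def jointScore (S : SensingSystem M Nt Nr L) (i : ParamIdx M) (y : Obs Nr L)
    (ζ : ParamIdx M → ℝ) : ℝ :=
  lineDeriv ℝ (fun z => Real.log (S.condPDF y z * S.paramPDF z)) ζ (Pi.single i 1)

section Random

variable {Ω : Type*} [MeasurableSpace Ω]

/-- `F_O`: the Fisher information matrix from the observation. -/
noncomputable def fimObs (S : SensingSystem M Nt Nr L) (P : Measure Ω)
    (Y : Ω → Obs Nr L) (ζ : Ω → ParamIdx M → ℝ) : Matrix (ParamIdx M) (ParamIdx M) ℝ :=
  Matrix.of fun i j => ∫ ω, S.obsScore i (Y ω) (ζ ω) * S.obsScore j (Y ω) (ζ ω) ∂P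

/-- `F_P`: the Fisher information matrix from the prior. -/
noncomputable def fimPrior (S : SensingSystem M Nt Nr L) (P : Measure Ω)
    (ζ : Ω → ParamIdx M → ℝ) : Matrix (ParamIdx M) (ParamIdx M) ℝ :=
  Matrix.of fun i j => ∫ ω, S.priorScore i (ζ ω) * S.priorScore j (ζ ω) ∂P

/-- `F`: the Bayesian Fisher information matrix, formed with the joint density of `Y` and `ζ`. -/
noncomputable def fim (S : SensingSystem M Nt Nr L) (P : Measure Ω)
    (Y : Ω → Obs Nr L) (ζ : Ω → ParamIdx M → ℝ) : Matrix (ParamIdx M) (ParamIdx M) ℝ :=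
  Matrix.of fun i j => ∫ ω, S.jointScore i (Y ω) (ζ ω) * S.jointScore j (Y ω) (ζ ω) ∂P

/-- `A_m = E[Ṁᴴ(θ_m) Ṁ(θ_m)]`. -/
noncomputable def Amat (S : SensingSystem M Nt Nr L) (P : Measure Ω) (θ : Ω → Fin M → ℝ)
    (m : Fin M) : Matrix (Fin Nt) (Fin Nt) ℂ :=
  Matrix.of fun i j => ∫ ω, ((S.respDeriv (θ ω m))ᴴ * S.respDeriv (θ ω m)) i j ∂P

/-- The MSE matrix `E[(g(Y) - ζ)(g(Y) - ζ)ᵀ]` of an estimator `g` of `ζ`. -/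
noncomputable def mseMatrix (P : Measure Ω) (g : Obs Nr L → ParamIdx M → ℝ)
    (Y : Ω → Obs Nr L) (ζ : Ω → ParamIdx M → ℝ) : Matrix (ParamIdx M) (ParamIdx M) ℝ :=
  Matrix.of fun i j => ∫ ω, (g (Y ω) i - ζ ω i) * (g (Y ω) j - ζ ω j) ∂P

end Random

/-- `β_m = 4 L σ_{α_m}² / σ²`. -/
noncomputable def beta (S : SensingSystem M Nt Nr L) (m : Fin M) : ℝ :=
  4 * L * S.sigmaAlpha m ^ 2 / S.noiseVar

end SensingSystem

/-! The bounds are instances of the van Trees (Bayesian Cramér-Rao) inequality. Let `s` be the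
gradient in `ζ` of the logarithm of the joint density. Integration by parts in `ζ` gives `E[φ s_j] =
-E[∂_j φ]` for test functions `φ(ζ, Y)` (`integral_mul_score_eq_neg`, `integral_mul_totalScore`).
For an error `e_i = g_i(Y) - ζ_i` this reads `E[e_i s_j] = δ_ij`, whatever the bias of `g`.
Nonnegativity of `E[(e - c·s)²]` for the best `c` then yields the bound by `F⁻¹`
(`dotProduct_inv_mulVec_le_integral_sq`); using the score of one angle alone yields the bound by `1
/ F_mm`.

Two points make this work without further regularity. Boundary terms vanish as soon as the products
in the integration by parts are integrable, which follows from square integrability. Zeros of the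
prior are harmless: a nonnegative differentiable `p` has zero gradient wherever it vanishes, so `∇p
= (∇p / p) p` holds everywhere with `0 / 0 = 0` (`hasLineDerivAt_div_mul_self`).

The structure of `F` comes from the noise and the coefficients. At the true parameters the
observation score is linear in the noise, with weights depending on `(θ, α)` only
(`obsDir_received`). Centred independent noise makes it orthogonal to every square integrable
function of the parameters, so `F = F_O + F_P`, and `F_O` is `2 / σ²` times the real Gram matrix of
the derivatives of the echo (`integral_obsDir_mul_obsDir`). The derivative in `θ_m` is `α_m Ṁ(θ_m)
X`, so `E[conj α_m α_n] = 2 σ_{α_m}² δ_mn` and `E[α_m] = 0` give the blocks of `F_O`. Positive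
definiteness follows by testing a vanishing combination of scores against `arctan ζ_i`
(`fim_posDef`).

For independent angles, the partial logarithmic derivative of the continuous prior density in `θ_m`
depends on `θ_m` only (`exists_score_eq_of_pi_eq_withDensity`). The centred scores of different
angles are then uncorrelated, row `m` of `F` is zero off the diagonal, and the two scalar bounds
coincide. -/

/-! ### Densities of products and the circular complex Gaussian law -/

theorem MeasureTheory.MeasurePreserving.withDensity_comp {α β : Type*} [MeasurableSpace α]
    [MeasurableSpace β] {μ : Measure α} {ν : Measure β} {e : α → β} (he : MeasurePreserving e μ ν)
    {g : β → ℝ≥0∞} (hg : Measurable g) :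
    MeasurePreserving e (μ.withDensity fun x => g (e x)) (ν.withDensity g) := by
  refine ⟨he.measurable, ?_⟩
  ext s hs
  rw [Measure.map_apply he.measurable hs, withDensity_apply _ (he.measurable hs),
    withDensity_apply _ hs, he.setLIntegral_comp_preimage hs hg]

/-- Both measures agree on boxes, where the integral of a product of one-variable functions factors.
Integrability allows real integrals in place of lower integrals. -/
theorem MeasureTheory.Measure.pi_withDensity_ofReal {ι : Type*} [Fintype ι] {E : ι → Type*}
    [∀ i, MeasurableSpace (E i)] (μ : ∀ i, Measure (E i)) [∀ i, SigmaFinite (μ i)]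
    {f : ∀ i, E i → ℝ} (hf : ∀ i, Integrable (f i) (μ i)) (h0 : ∀ i x, 0 ≤ f i x) :
    Measure.pi (fun i => (μ i).withDensity fun x => ENNReal.ofReal (f i x)) =
      (Measure.pi μ).withDensity fun x => ENNReal.ofReal (∏ i, f i (x i)) := by
  have hσ : ∀ i, IsFiniteMeasure ((μ i).withDensity fun x => ENNReal.ofReal (f i x)) :=
    fun i => isFiniteMeasure_withDensity_ofReal (hf i).2
  refine Measure.pi_eq fun s hs => ?_
  rw [withDensity_apply _ (MeasurableSet.univ_pi hs), Measure.restrict_pi_pi,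
    ← ofReal_integral_eq_lintegral_ofReal
      (Integrable.fintype_prod_dep fun i => (hf i).mono_measure Measure.restrict_le_self)
      (ae_of_all _ fun x => Finset.prod_nonneg fun i _ => h0 i _),
    integral_fintype_prod_eq_prod, ENNReal.ofReal_prod_of_nonneg
      fun i _ => integral_nonneg fun x => h0 i x]
  refine Finset.prod_congr rfl fun i _ => ?_
  rw [withDensity_apply _ (hs i), ofReal_integral_eq_lintegral_ofReal (hf i).integrableOn
    (ae_of_all _ fun x => h0 i x)]

/-- The density of `CN(0, v)`. -/
noncomputable def cscgPDF (v : ℝ) (z : ℂ) : ℝ := (Real.pi * v)⁻¹ * Real.exp (-‖z‖ ^ 2 / v)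

theorem cscgPDF_pos {v : ℝ} (hv : 0 < v) (z : ℂ) : 0 < cscgPDF v z := by
  unfold cscgPDF; positivity

theorem measurable_cscgPDF (v : ℝ) : Measurable (cscgPDF v) := by
  unfold cscgPDF; fun_prop

theorem cscg_eq (v : ℝ) : cscg v = volume.withDensity fun z => ENNReal.ofReal (cscgPDF v z) := rfl

/-- Since `‖z‖² = re² + im²`, the exponential splits; each real coordinate carries half of the
variance. Moments and independence of the coordinates are read off from this. -/
theorem cscgPDF_eq_mul {v : ℝ} (hv : 0 < v) (z : ℂ) :
    cscgPDF v z = gaussianPDFReal 0 (v / 2).toNNReal z.re *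
      gaussianPDFReal 0 (v / 2).toNNReal z.im := by
  have h : ((v / 2).toNNReal : ℝ) = v / 2 := Real.coe_toNNReal _ (by positivity)
  have h2 : 2 * Real.pi * (v / 2) = Real.pi * v := by ring
  have h3 : 2 * (v / 2) = v := by ring
  have h4 : (√(Real.pi * v))⁻¹ * (√(Real.pi * v))⁻¹ = (Real.pi * v)⁻¹ := by
    rw [← mul_inv, Real.mul_self_sqrt (by positivity)]
  rw [gaussianPDFReal, gaussianPDFReal, h, h2, h3, mul_mul_mul_comm, h4, ← Real.exp_add, cscgPDF,
    Complex.sq_norm, Complex.normSq_apply]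
  congr 2
  ring

/-- Real coordinates of a complex number. -/
def reim (z : ℂ) (r : Fin 2) : ℝ := if r = 0 then z.re else z.im

@[simp] theorem reim_zero (z : ℂ) : reim z 0 = z.re := rfl

@[simp] theorem reim_one (z : ℂ) : reim z 1 = z.im := rfl

theorem measurable_reim (r : Fin 2) : Measurable fun z => reim z r := by
  unfold reim; split_ifs <;> fun_prop

theorem measurePreserving_cscg {v : ℝ} (hv : 0 < v) :
    MeasurePreserving Complex.measurableEquivRealProd (cscg v)
      ((gaussianReal 0 (v / 2).toNNReal).prod (gaussianReal 0 (v / 2).toNNReal)) := by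
  have hne : (v / 2).toNNReal ≠ 0 := by simpa using hv
  rw [gaussianReal_of_var_ne_zero _ hne,
    prod_withDensity (measurable_gaussianPDF _ _) (measurable_gaussianPDF _ _)]
  have := Complex.volume_preserving_equiv_real_prod.withDensity_comp
    (g := fun p : ℝ × ℝ => gaussianPDF 0 (v / 2).toNNReal p.1 * gaussianPDF 0 (v / 2).toNNReal p.2)
    (((measurable_gaussianPDF _ _).comp measurable_fst).mul
      ((measurable_gaussianPDF _ _).comp measurable_snd))
  convert! this using 1
  rw [cscg_eq]
  congr 1
  ext z
  simp only [Complex.measurableEquivRealProd_apply, gaussianPDF]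
  rw [cscgPDF_eq_mul hv, ENNReal.ofReal_mul (gaussianPDFReal_nonneg _ _ _)]

theorem isProbabilityMeasure_cscg {v : ℝ} (hv : 0 < v) : IsProbabilityMeasure (cscg v) := by
  have h := (measurePreserving_cscg hv).measure_preimage MeasurableSet.univ.nullMeasurableSet
  exact ⟨by simpa using h⟩

theorem integrable_cscgPDF {v : ℝ} (hv : 0 < v) : Integrable (cscgPDF v) := by
  have := isProbabilityMeasure_cscg hv
  refine ⟨(measurable_cscgPDF v).aestronglyMeasurable, ?_⟩
  rw [hasFiniteIntegral_iff_ofReal (ae_of_all _ fun z => (cscgPDF_pos hv z).le),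
    ← setLIntegral_univ, ← withDensity_apply _ MeasurableSet.univ, ← cscg_eq]
  exact measure_lt_top _ _

/-! ### Moments of circular Gaussian variables in real coordinates -/

section Moments

variable {Ω : Type*} [MeasurableSpace Ω] {P : Measure Ω} {v : ℝ} {Z : Ω → ℂ}

theorem hasLaw_re_im_and_indepFun (hv : 0 < v) (hZ : HasLaw Z (cscg v) P) :
    HasLaw (fun ω => (Z ω).re) (gaussianReal 0 (v / 2).toNNReal) P ∧
    HasLaw (fun ω => (Z ω).im) (gaussianReal 0 (v / 2).toNNReal) P ∧
    IndepFun (fun ω => (Z ω).re) (fun ω => (Z ω).im) P := by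
  have := isProbabilityMeasure_cscg hv
  have := hZ.isProbabilityMeasure
  have h := (measurePreserving_cscg hv).comp_hasLaw hZ
  have h1 : HasLaw (fun ω => (Z ω).re) (gaussianReal 0 (v / 2).toNNReal) P :=
    measurePreserving_fst.comp_hasLaw h
  have h2 : HasLaw (fun ω => (Z ω).im) (gaussianReal 0 (v / 2).toNNReal) P :=
    measurePreserving_snd.comp_hasLaw h
  exact ⟨h1, h2, (indepFun_iff_hasLaw_prodMk_prod h1 h2).2 h⟩

theorem hasLaw_reim (hv : 0 < v) (hZ : HasLaw Z (cscg v) P) (r : Fin 2) :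
    HasLaw (fun ω => reim (Z ω) r) (gaussianReal 0 (v / 2).toNNReal) P := by
  obtain ⟨h1, h2, -⟩ := hasLaw_re_im_and_indepFun hv hZ
  fin_cases r
  · exact h1
  · exact h2

theorem memLp_reim (hv : 0 < v) (hZ : HasLaw Z (cscg v) P) (r : Fin 2) :
    MemLp (fun ω => reim (Z ω) r) 2 P := by
  have h := hasLaw_reim hv hZ r
  have h2 := memLp_id_gaussianReal' (μ := 0) (v := (v / 2).toNNReal) 2 (by simp)
  rw [← h.map_eq] at h2
  exact h2.comp_of_map h.aemeasurable

theorem memLp_of_hasLaw_cscg (hv : 0 < v) (hZ : HasLaw Z (cscg v) P) : MemLp Z 2 P :=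
  memLp_re_im_iff.1 ⟨memLp_reim hv hZ 0, memLp_reim hv hZ 1⟩

theorem integral_reim (hv : 0 < v) (hZ : HasLaw Z (cscg v) P) (r : Fin 2) :
    ∫ ω, reim (Z ω) r ∂P = 0 := by
  rw [(hasLaw_reim hv hZ r).integral_eq, integral_id_gaussianReal]

theorem integral_reim_mul_self (hv : 0 < v) (hZ : HasLaw Z (cscg v) P) (r : Fin 2) :
    ∫ ω, reim (Z ω) r * reim (Z ω) r ∂P = v / 2 := by
  have := isProbabilityMeasure_cscg hv
  have := hZ.isProbabilityMeasure
  have h1 := (hasLaw_reim hv hZ r).variance_eq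
  rw [variance_id_gaussianReal, variance_of_integral_eq_zero
    (hasLaw_reim hv hZ r).aemeasurable (integral_reim hv hZ r),
    Real.coe_toNNReal _ (by positivity)] at h1
  rw [← h1]
  exact integral_congr_ae (ae_of_all _ fun ω => by simp [pow_two])

theorem integral_reim_mul_reim (hv : 0 < v) (hZ : HasLaw Z (cscg v) P) (r s : Fin 2) :
    ∫ ω, reim (Z ω) r * reim (Z ω) s ∂P = if r = s then v / 2 else 0 := by
  have key : ∫ ω, (Z ω).re * (Z ω).im ∂P = 0 := by
    obtain ⟨h1, h2, h3⟩ := hasLaw_re_im_and_indepFun hv hZ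
    rw [h3.integral_fun_mul_eq_mul_integral h1.aemeasurable.aestronglyMeasurable
      h2.aemeasurable.aestronglyMeasurable]
    have := integral_reim hv hZ 0
    simp only [reim_zero] at this
    rw [this, zero_mul]
  have h := integral_reim_mul_self hv hZ
  fin_cases r <;> fin_cases s
  · simpa using h 0
  · simpa using key
  · simpa [mul_comm] using key
  · simpa using h 1

theorem integral_reim_mul_reim_family {ι : Type*} [DecidableEq ι] {v : ι → ℝ} {Z : ι → Ω → ℂ}
    (hv : ∀ i, 0 < v i) (hZ : ∀ i, HasLaw (Z i) (cscg (v i)) P) (hind : iIndepFun Z P)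
    (i j : ι) (r s : Fin 2) :
    ∫ ω, reim (Z i ω) r * reim (Z j ω) s ∂P = if i = j ∧ r = s then v i / 2 else 0 := by
  by_cases hij : i = j
  · subst hij
    simpa using integral_reim_mul_reim (hv i) (hZ i) r s
  · have h := (hind.indepFun hij).comp (measurable_reim r) (measurable_reim s)
    have h2 := h.integral_fun_mul_eq_mul_integral
      (hasLaw_reim (hv i) (hZ i) r).aemeasurable.aestronglyMeasurable
      (hasLaw_reim (hv j) (hZ j) s).aemeasurable.aestronglyMeasurable
    simp only [Function.comp_apply] at h2
    rw [h2, integral_reim (hv i) (hZ i), zero_mul, if_neg (fun h => hij h.1)]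

end Moments

theorem iIndepFun_of_hasLaw_pi {Ω ι : Type*} [MeasurableSpace Ω] {P : Measure Ω} [Fintype ι]
    {E : ι → Type*} [∀ i, MeasurableSpace (E i)] {μ : ∀ i, Measure (E i)}
    [∀ i, IsProbabilityMeasure (μ i)] {X : Ω → ∀ i, E i} (hX : HasLaw X (Measure.pi μ) P) :
    (∀ i, HasLaw (fun ω => X ω i) (μ i) P) ∧ iIndepFun (fun i ω => X ω i) P := by
  have := hX.isProbabilityMeasure
  have h : ∀ i, HasLaw (fun ω => X ω i) (μ i) P :=
    fun i => (measurePreserving_eval μ i).comp_hasLaw hX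
  exact ⟨h, (iIndepFun_iff_hasLaw_pi_pi h).2 hX⟩

/-- Joint independence of all entries depends on the law of `X` only. It is proved for the
coordinate maps on the iterated product space, where rows and entries are measurable functions, and
transported along `X`. -/
theorem iIndepFun_of_hasLaw_pi_pi {Ω ι κ E : Type*} [MeasurableSpace Ω] {P : Measure Ω} [Fintype ι]
    [Fintype κ] [MeasurableSpace E] {μ : Measure E}
    [IsProbabilityMeasure μ] {X : Ω → ι → κ → E}
    (hX : HasLaw X (Measure.pi fun _ => Measure.pi fun _ => μ) P) :
    (∀ p : ι × κ, HasLaw (fun ω => X ω p.1 p.2) μ P) ∧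
      iIndepFun (fun (p : ι × κ) ω => X ω p.1 p.2) P := by
  have := hX.isProbabilityMeasure
  obtain ⟨h1, h2⟩ := iIndepFun_of_hasLaw_pi hX
  have h3 := fun i => iIndepFun_of_hasLaw_pi (h1 i)
  refine ⟨fun p => (h3 p.1).1 p.2, ?_⟩
  have hid : HasLaw id (Measure.pi fun _ : ι => Measure.pi fun _ : κ => μ)
      (Measure.pi fun _ : ι => Measure.pi fun _ : κ => μ) := HasLaw.id
  obtain ⟨k1, k2⟩ := iIndepFun_of_hasLaw_pi hid
  have k3 := fun i => iIndepFun_of_hasLaw_pi (k1 i)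
  have k : iIndepFun (fun (p : ι × κ) (x : ι → κ → E) => x p.1 p.2)
      (Measure.pi fun _ : ι => Measure.pi fun _ : κ => μ) :=
    iIndepFun_uncurry' (X := fun i j (x : ι → κ → E) => x i j) (by fun_prop) k2 fun i => (k3 i).2
  have k' := (iIndepFun_iff_hasLaw_pi_pi fun p : ι × κ => (k3 p.1).1 p.2).1 k
  exact (iIndepFun_iff_hasLaw_pi_pi fun p : ι × κ => (h3 p.1).1 p.2).2 (k'.comp hX)

/-! ### The joint density of parameters and observation -/

namespace SensingSystem

variable {M Nt Nr L : ℕ}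

theorem pack_inl (θ : Fin M → ℝ) (α : Fin M → ℂ) (m : Fin M) :
    pack θ α (Sum.inl m) = θ m := rfl

theorem pack_inr (θ : Fin M → ℝ) (α : Fin M → ℂ) (q : Fin M × Fin 2) :
    pack θ α (Sum.inr q) = reim (α q.1) q.2 := rfl

@[simp] theorem angles_pack (θ : Fin M → ℝ) (α : Fin M → ℂ) : angles (pack θ α) = θ := rfl

@[simp] theorem coeffs_pack (θ : Fin M → ℝ) (α : Fin M → ℂ) : coeffs (pack θ α) = α := rfl

theorem measurable_pack :
    Measurable fun p : (Fin M → ℝ) × (Fin M → ℂ) => pack p.1 p.2 := by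
  refine measurable_pi_lambda _ fun i => ?_
  rcases i with m | q
  · simp only [pack_inl]; fun_prop
  · simp only [pack_inr]
    exact (measurable_reim q.2).comp (by fun_prop)

theorem measurable_angles : Measurable (angles (M := M)) := by
  unfold angles; fun_prop

theorem measurable_coeffs : Measurable (coeffs (M := M)) := by
  refine measurable_pi_lambda _ fun m => ?_
  exact Complex.measurableEquivRealProd.symm.measurable.comp
    (f := fun ζ : ParamIdx M → ℝ => (ζ (Sum.inr (m, 0)), ζ (Sum.inr (m, 1)))) (by fun_prop)

/-- The preimage of a box is a box of angles times a product of rectangles in `ℂ`, identified with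
`ℝ × ℝ`. -/
theorem measurePreserving_pack :
    MeasurePreserving fun p : (Fin M → ℝ) × (Fin M → ℂ) => pack p.1 p.2 := by
  refine ⟨measurable_pack, ?_⟩
  rw [volume_pi]
  refine (Measure.pi_eq fun s hs => ?_).symm
  rw [Measure.map_apply measurable_pack (MeasurableSet.univ_pi hs)]
  have hset : (fun p : (Fin M → ℝ) × (Fin M → ℂ) => pack p.1 p.2) ⁻¹' (Set.univ.pi s) =
      (Set.univ.pi fun m => s (Sum.inl m)) ×ˢ (Set.univ.pi fun m =>
        Complex.measurableEquivRealProd ⁻¹' (s (Sum.inr (m, 0)) ×ˢ s (Sum.inr (m, 1)))) := by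
    ext p
    simp only [Set.mem_preimage, Set.mem_univ_pi, Set.mem_prod, Sum.forall, Prod.forall,
      Fin.forall_fin_two, pack_inl, pack_inr, Complex.measurableEquivRealProd_apply, reim_zero,
      reim_one]
  rw [hset, Measure.volume_eq_prod, Measure.prod_prod, volume_pi_pi, volume_pi_pi,
    Fintype.prod_sum_type, Fintype.prod_prod_type]
  congr 1
  refine Finset.prod_congr rfl fun m _ => ?_
  rw [Complex.volume_preserving_equiv_real_prod.measure_preimage
    ((hs _).prod (hs _)).nullMeasurableSet, Measure.volume_eq_prod, Measure.prod_prod,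
    Fin.prod_univ_two]

variable (S : SensingSystem M Nt Nr L)

theorem alphaPDF_eq (hsigma : ∀ m, 0 < S.sigmaAlpha m) (m : Fin M) (x : ℝ) :
    S.alphaPDF m x = gaussianPDFReal 0 ((2 * S.sigmaAlpha m ^ 2) / 2).toNNReal x := by
  have hs := hsigma m
  have h : (((2 * S.sigmaAlpha m ^ 2) / 2).toNNReal : ℝ) = S.sigmaAlpha m ^ 2 := by
    rw [Real.coe_toNNReal _ (by positivity)]; ring
  have h2 : √(2 * Real.pi * S.sigmaAlpha m ^ 2) = √(2 * Real.pi) * S.sigmaAlpha m := by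
    rw [Real.sqrt_mul (by positivity), Real.sqrt_sq hs.le]
  rw [alphaPDF, gaussianPDFReal, h, h2, sub_zero, div_eq_inv_mul]

theorem alphaPDF_pos (hsigma : ∀ m, 0 < S.sigmaAlpha m) (m : Fin M) (x : ℝ) :
    0 < S.alphaPDF m x := by
  have := hsigma m
  unfold alphaPDF; positivity

theorem paramPDF_pack (hsigma : ∀ m, 0 < S.sigmaAlpha m) (θ : Fin M → ℝ) (α : Fin M → ℂ) :
    S.paramPDF (pack θ α) = S.prior θ * ∏ m, cscgPDF (2 * S.sigmaAlpha m ^ 2) (α m) := by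
  unfold paramPDF
  congr 1
  refine Finset.prod_congr rfl fun m _ => ?_
  have := hsigma m
  rw [cscgPDF_eq_mul (by positivity), S.alphaPDF_eq hsigma, S.alphaPDF_eq hsigma]
  rfl

theorem condPDF_eq (y : Obs Nr L) (ζ : ParamIdx M → ℝ) :
    S.condPDF y ζ = ∏ i, ∏ l, cscgPDF S.noiseVar (y i l - S.echo (angles ζ) (coeffs ζ) i l) := rfl

theorem condPDF_pos (hnoise : 0 < S.noiseVar) (y : Obs Nr L) (ζ : ParamIdx M → ℝ) :
    0 < S.condPDF y ζ :=
  Finset.prod_pos fun _ _ => Finset.prod_pos fun _ _ => cscgPDF_pos hnoise _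

theorem paramPDF_nonneg (hsigma : ∀ m, 0 < S.sigmaAlpha m) (hprior_nonneg : ∀ t, 0 ≤ S.prior t)
    (ζ : ParamIdx M → ℝ) : 0 ≤ S.paramPDF ζ :=
  mul_nonneg (hprior_nonneg _) (Finset.prod_nonneg fun m _ =>
    mul_nonneg (S.alphaPDF_pos hsigma m _).le (S.alphaPDF_pos hsigma m _).le)

theorem measurable_paramPDF (hprior : Measurable S.prior) : Measurable S.paramPDF := by
  unfold paramPDF alphaPDF
  have := measurable_angles (M := M)
  fun_prop

theorem hasDerivAt_resp (ha : Differentiable ℝ S.a) (hb : Differentiable ℝ S.b)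
    (i : Fin Nr) (k : Fin Nt) (t : ℝ) :
    HasDerivAt (fun s => S.resp s i k) (S.respDeriv t i k) t := by
  have h : DifferentiableAt ℝ (fun s => S.resp s i k) t := by
    have h1 : Differentiable ℝ fun s => S.a s k := differentiable_pi.1 ha k
    have h2 : Differentiable ℝ fun s => S.b s i := differentiable_pi.1 hb i
    exact (h2.mul h1.star).differentiableAt
  exact h.hasDerivAt

theorem measurable_resp (ha : Differentiable ℝ S.a) (hb : Differentiable ℝ S.b)
    (i : Fin Nr) (k : Fin Nt) : Measurable fun t => S.resp t i k :=
  (continuous_iff_continuousAt.2 fun t => (S.hasDerivAt_resp ha hb i k t).continuousAt).measurable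

theorem measurable_respDeriv (i : Fin Nr) (k : Fin Nt) :
    Measurable fun t => S.respDeriv t i k := measurable_deriv _

theorem echo_apply (θ : Fin M → ℝ) (α : Fin M → ℂ) (i : Fin Nr) (l : Fin L) :
    S.echo θ α i l = ∑ m, α m * (S.resp (θ m) * S.X) i l := by
  simp [echo, Matrix.sum_apply]

theorem measurable_echo (ha : Differentiable ℝ S.a) (hb : Differentiable ℝ S.b)
    (i : Fin Nr) (l : Fin L) :
    Measurable fun p : (Fin M → ℝ) × (Fin M → ℂ) => S.echo p.1 p.2 i l := by
  simp only [echo_apply, Matrix.mul_apply]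
  have h := S.measurable_resp ha hb
  refine Finset.measurable_sum _ fun m _ => Measurable.mul (by fun_prop) ?_
  refine Finset.measurable_sum _ fun k _ => Measurable.mul ?_ (by fun_prop)
  exact (h i k).comp (by fun_prop)

theorem measurable_angles_coeffs :
    Measurable fun ζ : ParamIdx M → ℝ => (angles ζ, coeffs ζ) :=
  measurable_angles.prodMk measurable_coeffs

theorem measurable_echo_param (ha : Differentiable ℝ S.a) (hb : Differentiable ℝ S.b)
    (i : Fin Nr) (l : Fin L) :
    Measurable fun ζ : ParamIdx M → ℝ => S.echo (angles ζ) (coeffs ζ) i l := by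
  have h := (S.measurable_echo ha hb i l).comp measurable_angles_coeffs
  exact h

theorem measurable_condPDF (ha : Differentiable ℝ S.a) (hb : Differentiable ℝ S.b) :
    Measurable fun z : (ParamIdx M → ℝ) × Obs Nr L => S.condPDF z.2 z.1 := by
  simp only [condPDF_eq]
  refine Finset.measurable_prod _ fun i _ => Finset.measurable_prod _ fun l _ => ?_
  refine (measurable_cscgPDF _).comp (Measurable.sub (by fun_prop) ?_)
  exact (S.measurable_echo_param ha hb i l).comp measurable_fst

section Law

variable {S} {Ω : Type*} [MeasurableSpace Ω] {P : Measure Ω} [IsProbabilityMeasure P]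
  {θ : Ω → Fin M → ℝ} {α : Ω → Fin M → ℂ} {N : Ω → Obs Nr L}

theorem hasLaw_param (hsigma : ∀ m, 0 < S.sigmaAlpha m)
    (hprior_nonneg : ∀ t, 0 ≤ S.prior t) (hprior : Measurable S.prior)
    (hθ : HasLaw θ (volume.withDensity fun t => ENNReal.ofReal (S.prior t)) P)
    (hα : HasLaw α (Measure.pi fun m => cscg (2 * S.sigmaAlpha m ^ 2)) P)
    (hθα : IndepFun θ α P) :
    HasLaw (fun ω => pack (θ ω) (α ω))
      (volume.withDensity fun ζ => ENNReal.ofReal (S.paramPDF ζ)) P := by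
  have hs : ∀ m, 0 < 2 * S.sigmaAlpha m ^ 2 := fun m => by have := hsigma m; positivity
  have hlaw := hθα.hasLaw_prod hθ hα
  simp only [cscg_eq] at hlaw
  rw [Measure.pi_withDensity_ofReal _ (fun m => integrable_cscgPDF (hs m))
    (fun m z => (cscgPDF_pos (hs m) z).le), ← volume_pi, prod_withDensity (by fun_prop)
    (by
      refine ENNReal.measurable_ofReal.comp (Finset.measurable_prod _ fun m _ => ?_)
      exact (measurable_cscgPDF _).comp (measurable_pi_apply m)), ← Measure.volume_eq_prod] at hlaw
  have h := (measurePreserving_pack (M := M)).withDensity_comp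
    (g := fun ζ => ENNReal.ofReal (S.paramPDF ζ)) (S.measurable_paramPDF hprior).ennreal_ofReal
  refine MeasurePreserving.comp_hasLaw (X := fun ω => (θ ω, α ω)) h ?_
  convert hlaw using 2
  ext p
  rw [S.paramPDF_pack hsigma, ENNReal.ofReal_mul (hprior_nonneg _)]

/-- By independence `(ζ, N)` has a product density. The map `(ζ, n) ↦ (ζ, μ(ζ) + n)` is a shear: it
translates each fibre, so it preserves Lebesgue measure and merely moves the density. -/
theorem hasLaw_param_received (hnoise : 0 < S.noiseVar) (hsigma : ∀ m, 0 < S.sigmaAlpha m)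
    (ha : Differentiable ℝ S.a) (hb : Differentiable ℝ S.b)
    (hprior_nonneg : ∀ t, 0 ≤ S.prior t) (hprior : Measurable S.prior)
    (hθ : HasLaw θ (volume.withDensity fun t => ENNReal.ofReal (S.prior t)) P)
    (hα : HasLaw α (Measure.pi fun m => cscg (2 * S.sigmaAlpha m ^ 2)) P)
    (hN : HasLaw N (Measure.pi fun _ => Measure.pi fun _ => cscg S.noiseVar) P)
    (hθα : IndepFun θ α P) (hζN : IndepFun (fun ω => (θ ω, α ω)) N P) :
    HasLaw (fun ω => (pack (θ ω) (α ω), S.received (θ ω) (α ω) (N ω)))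
      (volume.withDensity fun z : (ParamIdx M → ℝ) × Obs Nr L =>
        ENNReal.ofReal (S.condPDF z.2 z.1 * S.paramPDF z.1)) P := by
  have hpz := hasLaw_param hsigma hprior_nonneg hprior hθ hα hθα
  have hind : IndepFun (fun ω => pack (θ ω) (α ω)) N P :=
    hζN.comp measurable_pack measurable_id
  have hlaw := hind.hasLaw_prod hpz hN
  have hint : Integrable (fun x : Fin L → ℂ => ∏ l, cscgPDF S.noiseVar (x l)) :=
    Integrable.fintype_prod fun _ => integrable_cscgPDF hnoise
  simp only [cscg_eq] at hlaw
  rw [Measure.pi_withDensity_ofReal _ (fun _ => integrable_cscgPDF hnoise)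
      (fun _ z => (cscgPDF_pos hnoise z).le), ← volume_pi,
    Measure.pi_withDensity_ofReal _ (fun _ => hint)
      (fun _ z => Finset.prod_nonneg fun l _ => (cscgPDF_pos hnoise _).le), ← volume_pi,
    prod_withDensity (S.measurable_paramPDF hprior).ennreal_ofReal
    (by
      refine ENNReal.measurable_ofReal.comp (Finset.measurable_prod _ fun i _ =>
        Finset.measurable_prod _ fun l _ => ?_)
      exact (measurable_cscgPDF _).comp (by fun_prop)), ← Measure.volume_eq_prod] at hlaw
  have hmeas : Measurable fun z : (ParamIdx M → ℝ) × Obs Nr L =>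
      fun i l => S.echo (angles z.1) (coeffs z.1) i l + z.2 i l := by
    refine measurable_pi_lambda _ fun i => measurable_pi_lambda _ fun l => ?_
    exact ((S.measurable_echo_param ha hb i l).comp measurable_fst).add (by fun_prop)
  have hshear : MeasurePreserving fun z : (ParamIdx M → ℝ) × Obs Nr L =>
      (z.1, fun i l => S.echo (angles z.1) (coeffs z.1) i l + z.2 i l) := by
    have := (MeasurePreserving.id (volume : Measure (ParamIdx M → ℝ))).skew_product
      (μc := (volume : Measure (Obs Nr L))) (μd := (volume : Measure (Obs Nr L)))
      (g := fun ζ n i l => S.echo (angles ζ) (coeffs ζ) i l + n i l) hmeas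
      (ae_of_all _ fun ζ => (measurePreserving_add_left (volume : Measure (Obs Nr L))
        (fun i l => S.echo (angles ζ) (coeffs ζ) i l)).map_eq)
    exact this
  have h := hshear.withDensity_comp
    (g := fun z => ENNReal.ofReal (S.condPDF z.2 z.1 * S.paramPDF z.1))
    ((S.measurable_condPDF ha hb).mul
      ((S.measurable_paramPDF hprior).comp measurable_fst)).ennreal_ofReal
  refine MeasurePreserving.comp_hasLaw (X := fun ω => (pack (θ ω) (α ω), N ω)) h ?_
  convert hlaw using 2
  ext z
  rw [condPDF_eq, mul_comm, ENNReal.ofReal_mul (S.paramPDF_nonneg hsigma hprior_nonneg _)]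
  simp

end Law

end SensingSystem

/-! ### Logarithmic derivatives and the scores -/

theorem HasLineDerivAt.of_log {E : Type*} [AddCommGroup E] [Module ℝ E] {f : E → ℝ}
    (hf : ∀ x, 0 < f x) {s : ℝ} {x v : E}
    (h : HasLineDerivAt ℝ (fun z => Real.log (f z)) s x v) : HasLineDerivAt ℝ f (s * f x) x v := by
  have h1 := HasDerivAt.exp h
  simp only [Real.exp_log (hf _), zero_smul, add_zero] at h1
  rw [mul_comm] at h1
  exact h1

theorem HasLineDerivAt.log_of_mul {E : Type*} [AddCommGroup E] [Module ℝ E] {f : E → ℝ}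
    {s : ℝ} {x v : E} (hx : f x ≠ 0)
    (h : HasLineDerivAt ℝ f (s * f x) x v) : HasLineDerivAt ℝ (fun z => Real.log (f z)) s x v := by
  have h1 := HasDerivAt.log h (by simpa using hx)
  simp only [zero_smul, add_zero, mul_div_cancel_right₀ _ hx] at h1
  exact h1

theorem HasLineDerivAt.mul_of_mul {E : Type*} [AddCommGroup E] [Module ℝ E] {f g : E → ℝ}
    {s t : ℝ} {x v : E} (hf : HasLineDerivAt ℝ f (s * f x) x v)
    (hg : HasLineDerivAt ℝ g (t * g x) x v) :
    HasLineDerivAt ℝ (fun z => f z * g z) ((s + t) * (f x * g x)) x v := by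
  have h1 := HasDerivAt.mul hf hg
  simp only [zero_smul, add_zero] at h1
  exact h1.congr_deriv (by ring)

/-- A zero of a nonnegative function is a minimum, so the derivative vanishes there and the
convention `0 / 0 = 0` is the right one. Integration by parts can therefore cross the zero set of
the prior. -/
theorem hasLineDerivAt_div_mul_self {E : Type*} [NormedAddCommGroup E] [NormedSpace ℝ E]
    {p : E → ℝ} (hp : Differentiable ℝ p) (h0 : ∀ x, 0 ≤ p x) (x v : E) :
    HasLineDerivAt ℝ p (fderiv ℝ p x v / p x * p x) x v := by
  by_cases hx : p x = 0
  · have hmin : IsLocalMin p x := Filter.Eventually.of_forall fun y => hx ▸ h0 y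
    have h := (hp x).hasFDerivAt.hasLineDerivAt v
    rw [hmin.fderiv_eq_zero] at h
    simpa [hx] using h
  · rw [div_mul_cancel₀ _ hx]
    exact (hp x).hasFDerivAt.hasLineDerivAt v

namespace SensingSystem

variable {M Nt Nr L : ℕ} (S : SensingSystem M Nt Nr L)

/-- The derivative of the noiseless echo at `ζ` in the direction `v`. -/
noncomputable def echoDir (ζ v : ParamIdx M → ℝ) (i : Fin Nr) (l : Fin L) : ℂ :=
  ∑ m, (coeffs v m * (S.resp (angles ζ m) * S.X) i l +
    coeffs ζ m * (v (Sum.inl m) * (S.respDeriv (angles ζ m) * S.X) i l))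

/-- The derivative of `ln f(y | ζ)` in the direction `v`. -/
noncomputable def obsDir (y : Obs Nr L) (ζ v : ParamIdx M → ℝ) : ℝ :=
  ∑ i, ∑ l, ∑ r, 2 / S.noiseVar * (reim (y i l - S.echo (angles ζ) (coeffs ζ) i l) r *
    reim (S.echoDir ζ v i l) r)

/-- The derivative of `ln p_Z(ζ)` in the direction `v`. -/
noncomputable def priorDir (ζ v : ParamIdx M → ℝ) : ℝ :=
  fderiv ℝ S.prior (angles ζ) (angles v) / S.prior (angles ζ) +
    ∑ m, ∑ r, -(ζ (Sum.inr (m, r)) * v (Sum.inr (m, r)) / S.sigmaAlpha m ^ 2)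

theorem hasDerivAt_coord (ζ v : ParamIdx M → ℝ) (i : ParamIdx M) :
    HasDerivAt (fun t : ℝ => (ζ + t • v) i) (v i) 0 := by
  simpa using ((hasDerivAt_id (0 : ℝ)).mul_const (v i)).const_add (ζ i)

theorem hasDerivAt_coeffs (ζ v : ParamIdx M → ℝ) (m : Fin M) :
    HasDerivAt (fun t : ℝ => coeffs (ζ + t • v) m) (coeffs v m) 0 := by
  have h1 := (hasDerivAt_coord ζ v (Sum.inr (m, 0))).ofReal_comp
  have h2 := (hasDerivAt_coord ζ v (Sum.inr (m, 1))).ofReal_comp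
  have h := h1.add (h2.mul_const Complex.I)
  have e : ∀ w : ParamIdx M → ℝ, coeffs w m =
      (w (Sum.inr (m, 0)) : ℂ) + (w (Sum.inr (m, 1)) : ℂ) * Complex.I := fun w =>
    (Complex.mk_eq_add_mul_I _ _)
  simp only [e]
  exact h

theorem hasLineDerivAt_echo (ha : Differentiable ℝ S.a) (hb : Differentiable ℝ S.b)
    (ζ v : ParamIdx M → ℝ) (i : Fin Nr) (l : Fin L) :
    HasLineDerivAt ℝ (fun z => S.echo (angles z) (coeffs z) i l) (S.echoDir ζ v i l) ζ v := by
  simp only [HasLineDerivAt, echo_apply, echoDir]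
  refine HasDerivAt.fun_sum fun m _ => ?_
  have h1 := hasDerivAt_coeffs ζ v m
  have h2 : HasDerivAt (fun t : ℝ => (S.resp (angles (ζ + t • v) m) * S.X) i l)
      (v (Sum.inl m) * (S.respDeriv (angles ζ m) * S.X) i l) 0 := by
    simp only [Matrix.mul_apply, Finset.mul_sum]
    refine HasDerivAt.fun_sum fun k _ => ?_
    have h3 : HasDerivAt (fun s => S.resp s i k) (S.respDeriv (angles ζ m) i k)
        ((ζ + (0 : ℝ) • v) (Sum.inl m)) := by
      rw [zero_smul, add_zero]
      exact S.hasDerivAt_resp ha hb i k _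
    have h4 := (h3.scomp (0 : ℝ) (hasDerivAt_coord ζ v (Sum.inl m))).mul_const (S.X k l)
    refine h4.congr_deriv ?_
    rw [Complex.real_smul, mul_assoc]
  have h := h1.mul h2
  simp only [zero_smul, add_zero] at h
  exact h

theorem log_condPDF (hnoise : 0 < S.noiseVar) (y : Obs Nr L) (ζ : ParamIdx M → ℝ) :
    Real.log (S.condPDF y ζ) = ∑ i, ∑ l, (Real.log (Real.pi * S.noiseVar)⁻¹ +
      -‖y i l - S.echo (angles ζ) (coeffs ζ) i l‖ ^ 2 / S.noiseVar) := by
  have hc : (Real.pi * S.noiseVar)⁻¹ ≠ 0 := by positivity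
  rw [condPDF, Real.log_prod fun i _ => Finset.prod_ne_zero_iff.2 fun l _ => by positivity]
  refine Finset.sum_congr rfl fun i _ => ?_
  rw [Real.log_prod fun l _ => by positivity]
  refine Finset.sum_congr rfl fun l _ => ?_
  rw [Real.log_mul hc (Real.exp_pos _).ne', Real.log_exp]

theorem hasLineDerivAt_log_condPDF (hnoise : 0 < S.noiseVar)
    (ha : Differentiable ℝ S.a) (hb : Differentiable ℝ S.b)
    (y : Obs Nr L) (ζ v : ParamIdx M → ℝ) :
    HasLineDerivAt ℝ (fun z => Real.log (S.condPDF y z)) (S.obsDir y ζ v) ζ v := by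
  simp only [S.log_condPDF hnoise, HasLineDerivAt, obsDir]
  refine HasDerivAt.fun_sum fun i _ => HasDerivAt.fun_sum fun l _ => ?_
  have h := ((HasDerivAt.const_sub (y i l)
    (S.hasLineDerivAt_echo ha hb ζ v i l)).norm_sq.neg.div_const S.noiseVar).const_add
      (Real.log (Real.pi * S.noiseVar)⁻¹)
  refine h.congr_deriv ?_
  simp only [zero_smul, add_zero, Complex.inner, Fin.sum_univ_two, reim_zero, reim_one,
    Complex.mul_re, Complex.conj_re, Complex.conj_im, Complex.neg_re, Complex.neg_im]
  ring

theorem hasLineDerivAt_condPDF (hnoise : 0 < S.noiseVar)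
    (ha : Differentiable ℝ S.a) (hb : Differentiable ℝ S.b)
    (y : Obs Nr L) (ζ v : ParamIdx M → ℝ) :
    HasLineDerivAt ℝ (S.condPDF y) (S.obsDir y ζ v * S.condPDF y ζ) ζ v :=
  HasLineDerivAt.of_log (S.condPDF_pos hnoise y) (S.hasLineDerivAt_log_condPDF hnoise ha hb y ζ v)

theorem hasLineDerivAt_prod_alphaPDF (hsigma : ∀ m, 0 < S.sigmaAlpha m)
    (ζ v : ParamIdx M → ℝ) :
    HasLineDerivAt ℝ (fun z : ParamIdx M → ℝ =>
        ∏ m, S.alphaPDF m (z (Sum.inr (m, 0))) * S.alphaPDF m (z (Sum.inr (m, 1))))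
      ((∑ m, ∑ r, -(ζ (Sum.inr (m, r)) * v (Sum.inr (m, r)) / S.sigmaAlpha m ^ 2)) *
        ∏ m, S.alphaPDF m (ζ (Sum.inr (m, 0))) * S.alphaPDF m (ζ (Sum.inr (m, 1)))) ζ v := by
  have hpos := S.alphaPDF_pos hsigma
  have hlog : ∀ m x, Real.log (S.alphaPDF m x) =
      -x ^ 2 / (2 * S.sigmaAlpha m ^ 2) - Real.log (√(2 * Real.pi) * S.sigmaAlpha m) := by
    intro m x
    have := hsigma m
    rw [alphaPDF, Real.log_div (Real.exp_pos _).ne' (by positivity), Real.log_exp]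
  refine HasLineDerivAt.of_log (f := fun z : ParamIdx M → ℝ =>
        ∏ m, S.alphaPDF m (z (Sum.inr (m, 0))) * S.alphaPDF m (z (Sum.inr (m, 1))))
    (fun z => Finset.prod_pos fun m _ => mul_pos (hpos m _) (hpos m _)) ?_
  have hlog2 : ∀ z : ParamIdx M → ℝ, Real.log
      (∏ m, S.alphaPDF m (z (Sum.inr (m, 0))) * S.alphaPDF m (z (Sum.inr (m, 1)))) =
      ∑ m, ∑ r, Real.log (S.alphaPDF m (z (Sum.inr (m, r)))) := by
    intro z
    rw [Real.log_prod fun m _ => (mul_pos (hpos m _) (hpos m _)).ne']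
    refine Finset.sum_congr rfl fun m _ => ?_
    rw [Real.log_mul (hpos m _).ne' (hpos m _).ne', Fin.sum_univ_two]
  simp only [hlog2, hlog, HasLineDerivAt]
  refine HasDerivAt.fun_sum fun m _ => HasDerivAt.fun_sum fun r _ => ?_
  have h := (((hasDerivAt_coord ζ v (Sum.inr (m, r))).pow 2).neg.div_const
    (2 * S.sigmaAlpha m ^ 2)).sub_const (Real.log (√(2 * Real.pi) * S.sigmaAlpha m))
  refine h.congr_deriv ?_
  have := (hsigma m).ne'
  simp only [zero_smul, add_zero]
  field_simp
  norm_num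
  ring

theorem hasLineDerivAt_paramPDF (hsigma : ∀ m, 0 < S.sigmaAlpha m)
    (hprior_nonneg : ∀ t, 0 ≤ S.prior t) (hprior_diff : Differentiable ℝ S.prior)
    (ζ v : ParamIdx M → ℝ) :
    HasLineDerivAt ℝ S.paramPDF (S.priorDir ζ v * S.paramPDF ζ) ζ v := by
  refine HasLineDerivAt.mul_of_mul (f := fun z => S.prior (angles z)) ?_
    (S.hasLineDerivAt_prod_alphaPDF hsigma ζ v)
  exact hasLineDerivAt_div_mul_self hprior_diff hprior_nonneg (angles ζ) (angles v)

theorem hasLineDerivAt_joint (hnoise : 0 < S.noiseVar) (hsigma : ∀ m, 0 < S.sigmaAlpha m)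
    (ha : Differentiable ℝ S.a) (hb : Differentiable ℝ S.b)
    (hprior_nonneg : ∀ t, 0 ≤ S.prior t) (hprior_diff : Differentiable ℝ S.prior)
    (y : Obs Nr L) (ζ v : ParamIdx M → ℝ) :
    HasLineDerivAt ℝ (fun z => S.condPDF y z * S.paramPDF z)
      ((S.obsDir y ζ v + S.priorDir ζ v) * (S.condPDF y ζ * S.paramPDF ζ)) ζ v :=
  (S.hasLineDerivAt_condPDF hnoise ha hb y ζ v).mul_of_mul
    (S.hasLineDerivAt_paramPDF hsigma hprior_nonneg hprior_diff ζ v)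

theorem paramPDF_ne_zero (hsigma : ∀ m, 0 < S.sigmaAlpha m) {ζ : ParamIdx M → ℝ}
    (hζ : S.prior (angles ζ) ≠ 0) : S.paramPDF ζ ≠ 0 :=
  mul_ne_zero hζ (Finset.prod_pos fun m _ =>
    mul_pos (S.alphaPDF_pos hsigma m _) (S.alphaPDF_pos hsigma m _)).ne'

theorem obsScore_eq (hnoise : 0 < S.noiseVar)
    (ha : Differentiable ℝ S.a) (hb : Differentiable ℝ S.b)
    (i : ParamIdx M) (y : Obs Nr L) (ζ : ParamIdx M → ℝ) :
    S.obsScore i y ζ = S.obsDir y ζ (Pi.single i 1) :=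
  (S.hasLineDerivAt_log_condPDF hnoise ha hb y ζ _).lineDeriv

theorem priorScore_eq (hsigma : ∀ m, 0 < S.sigmaAlpha m)
    (hprior_nonneg : ∀ t, 0 ≤ S.prior t) (hprior_diff : Differentiable ℝ S.prior)
    (i : ParamIdx M) {ζ : ParamIdx M → ℝ} (hζ : S.prior (angles ζ) ≠ 0) :
    S.priorScore i ζ = S.priorDir ζ (Pi.single i 1) :=
  (HasLineDerivAt.log_of_mul (S.paramPDF_ne_zero hsigma hζ)
    (S.hasLineDerivAt_paramPDF hsigma hprior_nonneg hprior_diff ζ _)).lineDeriv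

theorem jointScore_eq (hnoise : 0 < S.noiseVar) (hsigma : ∀ m, 0 < S.sigmaAlpha m)
    (ha : Differentiable ℝ S.a) (hb : Differentiable ℝ S.b)
    (hprior_nonneg : ∀ t, 0 ≤ S.prior t) (hprior_diff : Differentiable ℝ S.prior)
    (i : ParamIdx M) (y : Obs Nr L) {ζ : ParamIdx M → ℝ} (hζ : S.prior (angles ζ) ≠ 0) :
    S.jointScore i y ζ = S.obsDir y ζ (Pi.single i 1) + S.priorDir ζ (Pi.single i 1) := by
  have h0 : S.condPDF y ζ * S.paramPDF ζ ≠ 0 :=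
    mul_ne_zero (S.condPDF_pos hnoise y ζ).ne' (S.paramPDF_ne_zero hsigma hζ)
  have h := S.hasLineDerivAt_joint hnoise hsigma ha hb hprior_nonneg hprior_diff y ζ
    (Pi.single i 1)
  exact (HasLineDerivAt.log_of_mul (f := fun z => S.condPDF y z * S.paramPDF z) h0 h).lineDeriv

end SensingSystem

/-! ### Integration by parts against a density -/

theorem integrable_withDensity_ofReal_iff {α : Type*} [MeasurableSpace α] {μ : Measure α}
    {q : α → ℝ} (hq : Measurable q) (h0 : ∀ x, 0 ≤ q x) {h : α → ℝ} :
    Integrable h (μ.withDensity fun x => ENNReal.ofReal (q x)) ↔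
      Integrable (fun x => h x * q x) μ := by
  rw [integrable_withDensity_iff_integrable_smul' hq.ennreal_ofReal
    (ae_of_all _ fun _ => ENNReal.ofReal_lt_top)]
  simp only [ENNReal.toReal_ofReal (h0 _), smul_eq_mul, mul_comm]

theorem integral_withDensity_ofReal {α : Type*} [MeasurableSpace α] {μ : Measure α}
    {q : α → ℝ} (hq : Measurable q) (h0 : ∀ x, 0 ≤ q x) (h : α → ℝ) :
    ∫ x, h x ∂(μ.withDensity fun x => ENNReal.ofReal (q x)) = ∫ x, h x * q x ∂μ := by
  rw [integral_withDensity_eq_integral_toReal_smul hq.ennreal_ofReal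
    (ae_of_all _ fun _ => ENNReal.ofReal_lt_top)]
  simp only [ENNReal.toReal_ofReal (h0 _), smul_eq_mul, mul_comm]

/-- Integration by parts against a joint density, in terms of its score `T` in the direction `v`
of the first variable. -/
theorem integral_mul_score_eq_neg {Ω E F : Type*} [MeasurableSpace Ω] {P : Measure Ω}
    [NormedAddCommGroup E] [NormedSpace ℝ E] [FiniteDimensional ℝ E] [MeasureSpace E] [BorelSpace E]
    [(volume : Measure E).IsAddHaarMeasure] [MeasureSpace F] [SFinite (volume : Measure F)]
    {X : Ω → E} {Y : Ω → F} {q T φ φ' : E × F → ℝ} {v : E}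
    (hq : Measurable q) (h0 : ∀ z, 0 ≤ q z)
    (hlaw : HasLaw (fun ω => (X ω, Y ω)) (volume.withDensity fun z => ENNReal.ofReal (q z)) P)
    (hT : Measurable T) (hφ : Measurable φ) (hφ' : Measurable φ')
    (hqT : ∀ x y, HasLineDerivAt ℝ (fun z => q (z, y)) (T (x, y) * q (x, y)) x v)
    (hφφ' : ∀ x y, HasLineDerivAt ℝ (fun z => φ (z, y)) (φ' (x, y)) x v)
    (hiφ : Integrable (fun ω => φ (X ω, Y ω)) P) (hiφ' : Integrable (fun ω => φ' (X ω, Y ω)) P)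
    (hiφT : Integrable (fun ω => φ (X ω, Y ω) * T (X ω, Y ω)) P) :
    ∫ ω, φ (X ω, Y ω) * T (X ω, Y ω) ∂P = -∫ ω, φ' (X ω, Y ω) ∂P := by
  have hI : ∀ {h : E × F → ℝ}, Measurable h → Integrable (fun ω => h (X ω, Y ω)) P →
      Integrable (fun z => h z * q z) (volume : Measure (E × F)) := by
    intro h hh hi
    rw [← integrable_withDensity_ofReal_iff hq h0, ← hlaw.map_eq,
      integrable_map_measure hh.aestronglyMeasurable hlaw.aemeasurable]
    exact hi
  have hE : ∀ {h : E × F → ℝ}, Measurable h →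
      ∫ ω, h (X ω, Y ω) ∂P = ∫ z, h z * q z := by
    intro h hh
    rw [← integral_withDensity_ofReal hq h0, ← hlaw.integral_comp hh.aestronglyMeasurable]
    rfl
  have i1 := hI hφ hiφ
  have i2 := hI hφ' hiφ'
  have i3 := hI (hφ.mul hT) hiφT
  have e1 := hE (hφ.mul hT)
  simp only [Pi.mul_apply] at i3 e1
  rw [e1, hE hφ']
  rw [Measure.volume_eq_prod] at i1 i2 i3 ⊢
  rw [integral_prod_symm _ i3, integral_prod_symm _ i2, ← integral_neg]
  refine integral_congr_ae ?_
  filter_upwards [i1.prod_left_ae, i2.prod_left_ae, i3.prod_left_ae] with y j1 j2 j3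
  -- For almost every `y` all three products are integrable on the slice; this replaces any
  -- assumption of decay at infinity.
  have := integral_bilinear_hasLineDerivAt_right_eq_neg_left_of_integrable
    (μ := (volume : Measure E)) (f := fun x => φ (x, y)) (f' := fun x => φ' (x, y))
    (g := fun x => q (x, y)) (g' := fun x => T (x, y) * q (x, y)) (v := v)
    (B := ContinuousLinearMap.mul ℝ ℝ) j2 (by simpa [mul_assoc] using j3) j1
    (fun x _ => hφφ' x y) (fun x _ => hqT x y)
  simpa [mul_assoc] using this

/-- The squared norms are independent and integrable, so their product is integrable. Without
independence, Hölder would only give a product in `L¹`. -/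
theorem ProbabilityTheory.IndepFun.memLp_two_mul {Ω 𝕜 : Type*} [MeasurableSpace Ω]
    {P : Measure Ω} [RCLike 𝕜] [MeasurableSpace 𝕜] [BorelSpace 𝕜] {f g : Ω → 𝕜}
    (hfg : IndepFun f g P) (hf : MemLp f 2 P) (hg : MemLp g 2 P) :
    MemLp (fun ω => f ω * g ω) 2 P := by
  change MemLp (f * g) 2 P
  rw [memLp_two_iff_integrable_sq_norm (hf.1.mul hg.1)]
  have h : IndepFun (fun ω => ‖f ω‖ ^ 2) (fun ω => ‖g ω‖ ^ 2) P :=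
    hfg.comp (φ := fun x => ‖x‖ ^ 2) (ψ := fun x => ‖x‖ ^ 2) (by fun_prop) (by fun_prop)
  have := h.integrable_mul ((memLp_two_iff_integrable_sq_norm hf.1).1 hf)
    ((memLp_two_iff_integrable_sq_norm hg.1).1 hg)
  simpa [mul_pow, Pi.mul_def] using this

/-! ### Linear forms in white noise with independent random weights -/

section WhiteNoise

variable {Ω A β : Type*} [MeasurableSpace Ω] {P : Measure Ω} [Fintype A]
  [MeasurableSpace β] {n : A → Ω → ℝ} {X : Ω → β}

theorem memLp_noise_sum (hn : ∀ a, MemLp (n a) 2 P) (hind : IndepFun X (fun ω a => n a ω) P)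
    {u : A → β → ℝ} (hu : ∀ a, Measurable (u a)) (hu2 : ∀ a, MemLp (fun ω => u a (X ω)) 2 P) :
    MemLp (fun ω => ∑ a, n a ω * u a (X ω)) 2 P := by
  refine memLp_finsetSum _ fun a _ => ?_
  have h : IndepFun (n a) (fun ω => u a (X ω)) P :=
    (hind.comp (hu a) (measurable_pi_apply a)).symm
  exact h.memLp_two_mul (hn a) (hu2 a)

theorem integral_noise_sum_mul [IsProbabilityMeasure P] (hn : ∀ a, MemLp (n a) 2 P) (hn0 : ∀ a, ∫ ω, n a ω ∂P = 0)
    (hind : IndepFun X (fun ω a => n a ω) P)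
    {u : A → β → ℝ} (hu : ∀ a, Measurable (u a)) (hu2 : ∀ a, MemLp (fun ω => u a (X ω)) 2 P)
    {h : β → ℝ} (hh : Measurable h) (hh2 : MemLp (fun ω => h (X ω)) 2 P) :
    ∫ ω, (∑ a, n a ω * u a (X ω)) * h (X ω) ∂P = 0 := by
  simp only [Finset.sum_mul, mul_assoc]
  have hi : ∀ a, IndepFun (n a) (fun ω => u a (X ω) * h (X ω)) P := fun a =>
    (hind.comp ((hu a).mul hh) (measurable_pi_apply a)).symm
  have hint : ∀ a, Integrable (fun ω => u a (X ω) * h (X ω)) P := fun a =>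
    (hu2 a).integrable_mul hh2
  have hint' : ∀ a, Integrable (fun ω => n a ω * (u a (X ω) * h (X ω))) P := fun a =>
    (hi a).integrable_mul ((hn a).integrable one_le_two) (hint a)
  rw [integral_finsetSum _ fun a _ => hint' a]
  refine Finset.sum_eq_zero fun a _ => ?_
  rw [(hi a).integral_fun_mul_eq_mul_integral (hn a).1 (hint a).1, hn0, zero_mul]

/-- Each term of the double sum factors into a noise covariance and a moment of the weights; the
covariance `w • 1` leaves the diagonal only. -/
theorem integral_noise_sum_mul_noise_sum [DecidableEq A] {w : ℝ} (hn : ∀ a, MemLp (n a) 2 P)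
    (hnn : ∀ a b, ∫ ω, n a ω * n b ω ∂P = if a = b then w else 0)
    (hind : IndepFun X (fun ω a => n a ω) P)
    {u u' : A → β → ℝ} (hu : ∀ a, Measurable (u a)) (hu2 : ∀ a, MemLp (fun ω => u a (X ω)) 2 P)
    (hu' : ∀ a, Measurable (u' a)) (hu2' : ∀ a, MemLp (fun ω => u' a (X ω)) 2 P) :
    ∫ ω, (∑ a, n a ω * u a (X ω)) * (∑ a, n a ω * u' a (X ω)) ∂P =
      w * ∑ a, ∫ ω, u a (X ω) * u' a (X ω) ∂P := by
  have hi : ∀ a b, IndepFun (fun ω => n a ω * n b ω) (fun ω => u a (X ω) * u' b (X ω)) P :=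
    fun a b => (hind.comp (φ := fun x => u a x * u' b x) (ψ := fun y : A → ℝ => y a * y b)
      ((hu a).mul (hu' b)) (by fun_prop)).symm
  have j1 : ∀ a b, Integrable (fun ω => n a ω * n b ω) P := fun a b =>
    (hn a).integrable_mul (hn b)
  have j2 : ∀ a b, Integrable (fun ω => u a (X ω) * u' b (X ω)) P := fun a b =>
    (hu2 a).integrable_mul (hu2' b)
  simp only [Finset.sum_mul_sum, mul_mul_mul_comm _ (u _ _)]
  have j3 : ∀ a b, Integrable (fun ω => n a ω * n b ω * (u a (X ω) * u' b (X ω))) P :=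
    fun a b => (hi a b).integrable_mul (j1 a b) (j2 a b)
  rw [integral_finsetSum _ fun a _ => integrable_finsetSum _ fun b _ => j3 a b, Finset.mul_sum]
  refine Finset.sum_congr rfl fun a _ => ?_
  rw [integral_finsetSum _ fun b _ => j3 a b]
  simp only [(hi _ _).integral_fun_mul_eq_mul_integral (j1 _ _).1 (j2 _ _).1, hnn, ite_mul,
    zero_mul, Finset.sum_ite_eq, Finset.mem_univ, if_true]

end WhiteNoise

/-! ### The model and the second moments of the observation score -/

namespace SensingSystem

variable {M Nt Nr L : ℕ} {S : SensingSystem M Nt Nr L}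

/-- The statistical model: Gaussian reflection coefficients and noise, a differentiable prior
density of the angles, and finite second moments in the Fisher information. -/
structure IsModel (S : SensingSystem M Nt Nr L) {Ω : Type*} [MeasurableSpace Ω] (P : Measure Ω)
    (θ : Ω → Fin M → ℝ) (α : Ω → Fin M → ℂ) (N : Ω → Obs Nr L) : Prop where
  isProbabilityMeasure : IsProbabilityMeasure P
  noise_pos : 0 < S.noiseVar
  sigma_pos : ∀ m, 0 < S.sigmaAlpha m
  diff_a : Differentiable ℝ S.a
  diff_b : Differentiable ℝ S.b
  prior_nonneg : ∀ t, 0 ≤ S.prior t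
  prior_diff : Differentiable ℝ S.prior
  law_angles : HasLaw θ (volume.withDensity fun t => ENNReal.ofReal (S.prior t)) P
  law_coeffs : HasLaw α (Measure.pi fun m => cscg (2 * S.sigmaAlpha m ^ 2)) P
  law_noise : HasLaw N (Measure.pi fun _ => Measure.pi fun _ => cscg S.noiseVar) P
  indep_angles_coeffs : IndepFun θ α P
  indep_noise : IndepFun (fun ω => (θ ω, α ω)) N P
  memLp_resp : ∀ m i k, MemLp (fun ω => S.resp (θ ω m) i k) 2 P
  memLp_respDeriv : ∀ m i k, MemLp (fun ω => S.respDeriv (θ ω m) i k) 2 P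
  integrable_score_sq : ∀ m, Integrable
    (fun ω => (lineDeriv ℝ (fun t => Real.log (S.prior t)) (θ ω) (Pi.single m 1)) ^ 2) P

theorem measurable_echoDir (ha : Differentiable ℝ S.a) (hb : Differentiable ℝ S.b)
    (v : ParamIdx M → ℝ) (i : Fin Nr) (l : Fin L) :
    Measurable fun ζ : ParamIdx M → ℝ => S.echoDir ζ v i l := by
  have h := S.measurable_resp ha hb
  have h' := S.measurable_respDeriv
  have hA : ∀ m : Fin M, Measurable fun ζ : ParamIdx M → ℝ => angles ζ m :=
    fun m => (measurable_pi_apply m).comp measurable_angles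
  have hC : ∀ m : Fin M, Measurable fun ζ : ParamIdx M → ℝ => coeffs ζ m :=
    fun m => (measurable_pi_apply m).comp measurable_coeffs
  simp only [echoDir, Matrix.mul_apply]
  refine Finset.measurable_sum _ fun m _ => Measurable.add ?_ ?_
  · refine Measurable.const_mul (Finset.measurable_sum _ fun k _ => ?_) _
    exact ((h i k).comp (hA m)).mul_const _
  · refine (hC m).mul (Measurable.const_mul (Finset.measurable_sum _ fun k _ => ?_) _)
    exact ((h' i k).comp (hA m)).mul_const _

theorem measurable_obsDir (ha : Differentiable ℝ S.a) (hb : Differentiable ℝ S.b)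
    (v : ParamIdx M → ℝ) :
    Measurable fun z : (ParamIdx M → ℝ) × Obs Nr L => S.obsDir z.2 z.1 v := by
  unfold obsDir
  refine Finset.measurable_sum _ fun i _ => Finset.measurable_sum _ fun l _ =>
    Finset.measurable_sum _ fun r _ => Measurable.const_mul (Measurable.mul ?_ ?_) _
  · refine (measurable_reim r).comp (Measurable.sub (by fun_prop) ?_)
    exact (S.measurable_echo_param ha hb i l).comp measurable_fst
  · exact (measurable_reim r).comp ((measurable_echoDir ha hb v i l).comp measurable_fst)

theorem measurable_priorDir (hp : Differentiable ℝ S.prior) (v : ParamIdx M → ℝ) :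
    Measurable fun ζ : ParamIdx M → ℝ => S.priorDir ζ v := by
  unfold priorDir
  refine Measurable.add (Measurable.div ?_ ?_) (by fun_prop)
  · exact (measurable_fderiv_apply_const ℝ S.prior (angles v)).comp measurable_angles
  · exact hp.continuous.measurable.comp measurable_angles

theorem memLp_complex_reim {Ω : Type*} [MeasurableSpace Ω] {P : Measure Ω} {f : Ω → ℂ}
    (hf : MemLp f 2 P) (r : Fin 2) : MemLp (fun ω => reim (f ω) r) 2 P := by
  fin_cases r
  · exact hf.re
  · exact hf.im

theorem priorDir_inl (ζ : ParamIdx M → ℝ) (m : Fin M) :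
    S.priorDir ζ (Pi.single (Sum.inl m) 1) =
      fderiv ℝ S.prior (angles ζ) (Pi.single m 1) / S.prior (angles ζ) := by
  have h : angles (Pi.single (Sum.inl m) (1 : ℝ)) = Pi.single m 1 := by
    ext n; simp [angles, Pi.single_apply]
  simp [priorDir, h]

theorem priorDir_inr (ζ : ParamIdx M → ℝ) (q : Fin M × Fin 2) :
    S.priorDir ζ (Pi.single (Sum.inr q) 1) = -(ζ (Sum.inr q) / S.sigmaAlpha q.1 ^ 2) := by
  have h : angles (Pi.single (Sum.inr q : ParamIdx M) (1 : ℝ)) = 0 := by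
    ext n; simp [angles]
  rw [priorDir, h, map_zero, zero_div, zero_add, ← Fintype.sum_prod_type'
    (f := fun m r => -(ζ (Sum.inr (m, r)) * (Pi.single (Sum.inr q) (1 : ℝ) : ParamIdx M → ℝ)
      (Sum.inr (m, r)) / S.sigmaAlpha m ^ 2)), Finset.sum_eq_single q]
  · simp
  · intro p _ hp
    simp [hp]
  · simp

namespace IsModel

variable {Ω : Type*} [MeasurableSpace Ω] {P : Measure Ω}
  {θ : Ω → Fin M → ℝ} {α : Ω → Fin M → ℂ} {N : Ω → Obs Nr L}

theorem hasLaw_coeff (H : S.IsModel P θ α N) (m : Fin M) :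
    HasLaw (fun ω => α ω m) (cscg (2 * S.sigmaAlpha m ^ 2)) P := by
  have := fun m => isProbabilityMeasure_cscg (v := 2 * S.sigmaAlpha m ^ 2)
    (by have := H.sigma_pos m; positivity)
  exact (iIndepFun_of_hasLaw_pi H.law_coeffs).1 m

theorem iIndepFun_coeff (H : S.IsModel P θ α N) : iIndepFun (fun m ω => α ω m) P := by
  have := fun m => isProbabilityMeasure_cscg (v := 2 * S.sigmaAlpha m ^ 2)
    (by have := H.sigma_pos m; positivity)
  exact (iIndepFun_of_hasLaw_pi H.law_coeffs).2

theorem var_pos (H : S.IsModel P θ α N) (m : Fin M) : 0 < 2 * S.sigmaAlpha m ^ 2 := by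
  have := H.sigma_pos m; positivity

theorem memLp_coeff (H : S.IsModel P θ α N) (m : Fin M) : MemLp (fun ω => α ω m) 2 P :=
  memLp_of_hasLaw_cscg (H.var_pos m) (H.hasLaw_coeff m)

theorem integral_coeff_reim_mul (H : S.IsModel P θ α N) (p q : Fin M × Fin 2) :
    ∫ ω, reim (α ω p.1) p.2 * reim (α ω q.1) q.2 ∂P =
      if p = q then S.sigmaAlpha p.1 ^ 2 else 0 := by
  rw [integral_reim_mul_reim_family (Z := fun m ω => α ω m) H.var_pos H.hasLaw_coeff
    H.iIndepFun_coeff, mul_div_cancel_left₀ _ two_ne_zero]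
  simp only [Prod.ext_iff]

theorem integral_coeff (H : S.IsModel P θ α N) (m : Fin M) : ∫ ω, α ω m ∂P = 0 := by
  have := H.isProbabilityMeasure
  have h := integral_re_add_im ((H.memLp_coeff m).integrable one_le_two)
  have h0 := integral_reim (H.var_pos m) (H.hasLaw_coeff m) 0
  have h1 := integral_reim (H.var_pos m) (H.hasLaw_coeff m) 1
  simp only [reim_zero, reim_one] at h0 h1
  rw [← h]
  simp [h0, h1]

theorem integral_conj_coeff_mul (H : S.IsModel P θ α N) (m n : Fin M) :
    ∫ ω, (starRingEnd ℂ) (α ω m) * α ω n ∂P =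
      if m = n then 2 * (S.sigmaAlpha m : ℂ) ^ 2 else 0 := by
  have hL := memLp_complex_reim (H.memLp_coeff m)
  have hL' := memLp_complex_reim (H.memLp_coeff n)
  have hi : Integrable (fun ω => (starRingEnd ℂ) (α ω m) * α ω n) P :=
    (H.memLp_coeff m).star.integrable_mul (H.memLp_coeff n)
  have hint : ∀ r s, Integrable (fun ω => reim (α ω m) r * reim (α ω n) s) P :=
    fun r s => (hL r).integrable_mul (hL' s)
  have hre : ∫ ω, ((starRingEnd ℂ) (α ω m) * α ω n).re ∂P =
      if m = n then 2 * S.sigmaAlpha m ^ 2 else 0 := by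
    have h : ∀ ω, ((starRingEnd ℂ) (α ω m) * α ω n).re =
        reim (α ω m) 0 * reim (α ω n) 0 + reim (α ω m) 1 * reim (α ω n) 1 := by
      intro ω; simp
    simp only [h]
    rw [integral_add (hint 0 0) (hint 1 1), H.integral_coeff_reim_mul (m, 0) (n, 0),
      H.integral_coeff_reim_mul (m, 1) (n, 1)]
    by_cases hmn : m = n <;> simp [hmn]; ring
  have him : ∫ ω, ((starRingEnd ℂ) (α ω m) * α ω n).im ∂P = 0 := by
    have h : ∀ ω, ((starRingEnd ℂ) (α ω m) * α ω n).im =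
        reim (α ω m) 0 * reim (α ω n) 1 - reim (α ω m) 1 * reim (α ω n) 0 := by
      intro ω; simp; ring
    simp only [h]
    rw [integral_sub (hint 0 1) (hint 1 0), H.integral_coeff_reim_mul (m, 0) (n, 1),
      H.integral_coeff_reim_mul (m, 1) (n, 0)]
    simp
  have h := integral_re_add_im hi
  simp only [RCLike.re_eq_complex_re, RCLike.im_eq_complex_im] at h
  rw [← h, hre, him]
  split_ifs <;> simp

theorem indep_angle_coeff (H : S.IsModel P θ α N) {f : (Fin M → ℝ) → ℂ} (hf : Measurable f)
    {g : (Fin M → ℂ) → ℂ} (hg : Measurable g) :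
    IndepFun (fun ω => g (α ω)) (fun ω => f (θ ω)) P :=
  (H.indep_angles_coeffs.comp hf hg).symm

theorem measurable_resp_mul (H : S.IsModel P θ α N) (m : Fin M) (i : Fin Nr) (l : Fin L) :
    Measurable fun t : Fin M → ℝ => (S.resp (t m) * S.X) i l := by
  simp only [Matrix.mul_apply]
  exact Finset.measurable_sum _ fun k _ =>
    ((S.measurable_resp H.diff_a H.diff_b i k).comp (measurable_pi_apply m)).mul_const _

theorem measurable_respDeriv_mul (m : Fin M) (i : Fin Nr) (l : Fin L) :
    Measurable fun t : Fin M → ℝ => (S.respDeriv (t m) * S.X) i l := by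
  simp only [Matrix.mul_apply]
  exact Finset.measurable_sum _ fun k _ =>
    ((S.measurable_respDeriv i k).comp (measurable_pi_apply m)).mul_const _

theorem memLp_resp_mul (H : S.IsModel P θ α N) (m : Fin M) (i : Fin Nr) (l : Fin L) :
    MemLp (fun ω => (S.resp (θ ω m) * S.X) i l) 2 P := by
  simp only [Matrix.mul_apply]
  exact memLp_finsetSum _ fun k _ => (H.memLp_resp m i k).mul_const _

theorem memLp_respDeriv_mul (H : S.IsModel P θ α N) (m : Fin M) (i : Fin Nr) (l : Fin L) :
    MemLp (fun ω => (S.respDeriv (θ ω m) * S.X) i l) 2 P := by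
  simp only [Matrix.mul_apply]
  exact memLp_finsetSum _ fun k _ => (H.memLp_respDeriv m i k).mul_const _

theorem memLp_echoDir (H : S.IsModel P θ α N) (v : ParamIdx M → ℝ) (i : Fin Nr) (l : Fin L) :
    MemLp (fun ω => S.echoDir (pack (θ ω) (α ω)) v i l) 2 P := by
  simp only [echoDir, angles_pack, coeffs_pack]
  refine memLp_finsetSum _ fun m _ => MemLp.add ((H.memLp_resp_mul m i l).const_mul _) ?_
  refine IndepFun.memLp_two_mul ?_ (H.memLp_coeff m) ((H.memLp_respDeriv_mul m i l).const_mul _)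
  exact H.indep_angle_coeff ((measurable_respDeriv_mul m i l).const_mul _)
    (g := fun a => a m) (measurable_pi_apply m)

/-- The real coordinates of the noise. -/
noncomputable def noiseCoord (N : Ω → Obs Nr L) (a : (Fin Nr × Fin L) × Fin 2) (ω : Ω) : ℝ :=
  reim (N ω a.1.1 a.1.2) a.2

theorem hasLaw_noise_entry (H : S.IsModel P θ α N) (p : Fin Nr × Fin L) :
    HasLaw (fun ω => N ω p.1 p.2) (cscg S.noiseVar) P := by
  have := isProbabilityMeasure_cscg H.noise_pos
  exact (iIndepFun_of_hasLaw_pi_pi H.law_noise).1 p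

theorem memLp_noiseCoord (H : S.IsModel P θ α N) (a : (Fin Nr × Fin L) × Fin 2) :
    MemLp (noiseCoord N a) 2 P :=
  memLp_reim H.noise_pos (H.hasLaw_noise_entry a.1) a.2

theorem integral_noiseCoord (H : S.IsModel P θ α N) (a : (Fin Nr × Fin L) × Fin 2) :
    ∫ ω, noiseCoord N a ω ∂P = 0 :=
  integral_reim H.noise_pos (H.hasLaw_noise_entry a.1) a.2

theorem integral_noiseCoord_mul (H : S.IsModel P θ α N) (a b : (Fin Nr × Fin L) × Fin 2) :
    ∫ ω, noiseCoord N a ω * noiseCoord N b ω ∂P = if a = b then S.noiseVar / 2 else 0 := by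
  have := isProbabilityMeasure_cscg H.noise_pos
  have h := integral_reim_mul_reim_family (Z := fun (p : Fin Nr × Fin L) ω => N ω p.1 p.2)
    (fun _ => H.noise_pos) H.hasLaw_noise_entry (iIndepFun_of_hasLaw_pi_pi H.law_noise).2
    a.1 b.1 a.2 b.2
  simp only [← Prod.ext_iff] at h
  exact h

theorem indep_noiseCoord (H : S.IsModel P θ α N) :
    IndepFun (fun ω => (θ ω, α ω)) (fun ω a => noiseCoord N a ω) P := by
  refine H.indep_noise.comp (φ := id) (ψ := fun (y : Obs Nr L)
    (a : (Fin Nr × Fin L) × Fin 2) => reim (y a.1.1 a.1.2) a.2) measurable_id ?_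
  exact measurable_pi_lambda _ fun a => (measurable_reim a.2).comp (by fun_prop)

/-- The coefficient of a noise coordinate in the score of the observation. -/
noncomputable def noiseCoeff (S : SensingSystem M Nt Nr L) (v : ParamIdx M → ℝ)
    (a : (Fin Nr × Fin L) × Fin 2) (p : (Fin M → ℝ) × (Fin M → ℂ)) : ℝ :=
  2 / S.noiseVar * reim (S.echoDir (pack p.1 p.2) v a.1.1 a.1.2) a.2

theorem measurable_noiseCoeff (H : S.IsModel P θ α N) (v : ParamIdx M → ℝ)
    (a : (Fin Nr × Fin L) × Fin 2) : Measurable (noiseCoeff S v a) :=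
  (((measurable_reim a.2).comp (measurable_echoDir H.diff_a H.diff_b v a.1.1 a.1.2)).comp
    measurable_pack).const_mul _

theorem memLp_noiseCoeff (H : S.IsModel P θ α N) (v : ParamIdx M → ℝ)
    (a : (Fin Nr × Fin L) × Fin 2) : MemLp (fun ω => noiseCoeff S v a (θ ω, α ω)) 2 P :=
  (memLp_complex_reim (H.memLp_echoDir v a.1.1 a.1.2) a.2).const_mul _

omit [MeasurableSpace Ω] in
-- At the true parameters the residual `Y - μ(ζ)` is the noise itself, so the score is a linear form
-- in the noise.
theorem obsDir_received (v : ParamIdx M → ℝ) (ω : Ω) :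
    S.obsDir (S.received (θ ω) (α ω) (N ω)) (pack (θ ω) (α ω)) v =
      ∑ a, noiseCoord N a ω * noiseCoeff S v a (θ ω, α ω) := by
  simp only [Fintype.sum_prod_type, obsDir, received, angles_pack, coeffs_pack, noiseCoord,
    noiseCoeff, add_sub_cancel_left]
  refine Finset.sum_congr rfl fun i _ => Finset.sum_congr rfl fun l _ =>
    Finset.sum_congr rfl fun r _ => ?_
  ring

theorem memLp_obsDir (H : S.IsModel P θ α N) (v : ParamIdx M → ℝ) :
    MemLp (fun ω => S.obsDir (S.received (θ ω) (α ω) (N ω)) (pack (θ ω) (α ω)) v) 2 P := by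
  simp only [obsDir_received]
  exact memLp_noise_sum H.memLp_noiseCoord H.indep_noiseCoord (H.measurable_noiseCoeff v)
    (H.memLp_noiseCoeff v)

/-- The noise is centred and independent of the parameters. This kills the cross terms between
observation and prior. -/
theorem integral_obsDir_mul (H : S.IsModel P θ α N) (v : ParamIdx M → ℝ)
    {h : (ParamIdx M → ℝ) → ℝ} (hh : Measurable h)
    (hh2 : MemLp (fun ω => h (pack (θ ω) (α ω))) 2 P) :
    ∫ ω, S.obsDir (S.received (θ ω) (α ω) (N ω)) (pack (θ ω) (α ω)) v *
      h (pack (θ ω) (α ω)) ∂P = 0 := by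
  have := H.isProbabilityMeasure
  simp only [obsDir_received]
  exact integral_noise_sum_mul H.memLp_noiseCoord H.integral_noiseCoord H.indep_noiseCoord
    (H.measurable_noiseCoeff v) (H.memLp_noiseCoeff v)
    (h := fun p => h (pack p.1 p.2)) (hh.comp measurable_pack) hh2

/-- The constant is `(σ² / 2) (2 / σ²)² = 2 / σ²`: variance of a real noise coordinate times the
squared factor of the score. The two real coordinates recombine into the real part of a Hermitian
product. -/
theorem integral_obsDir_mul_obsDir (H : S.IsModel P θ α N) (v w : ParamIdx M → ℝ) :
    ∫ ω, S.obsDir (S.received (θ ω) (α ω) (N ω)) (pack (θ ω) (α ω)) v *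
        S.obsDir (S.received (θ ω) (α ω) (N ω)) (pack (θ ω) (α ω)) w ∂P =
      2 / S.noiseVar * (∑ i, ∑ l, ∫ ω, (starRingEnd ℂ) (S.echoDir (pack (θ ω) (α ω)) v i l) *
        S.echoDir (pack (θ ω) (α ω)) w i l ∂P).re := by
  have hne := H.noise_pos.ne'
  simp only [obsDir_received]
  rw [integral_noise_sum_mul_noise_sum H.memLp_noiseCoord H.integral_noiseCoord_mul
    H.indep_noiseCoord (H.measurable_noiseCoeff v) (H.memLp_noiseCoeff v)
    (H.measurable_noiseCoeff w) (H.memLp_noiseCoeff w)]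
  simp only [Fintype.sum_prod_type, noiseCoeff, Complex.re_sum, Finset.mul_sum]
  refine Finset.sum_congr rfl fun i _ => Finset.sum_congr rfl fun l _ => ?_
  have hv := H.memLp_echoDir v i l
  have hw := H.memLp_echoDir w i l
  have hint : ∀ r, Integrable (fun ω => reim (S.echoDir (pack (θ ω) (α ω)) v i l) r *
      reim (S.echoDir (pack (θ ω) (α ω)) w i l) r) P := fun r =>
    (memLp_complex_reim hv r).integrable_mul (memLp_complex_reim hw r)
  have hi : Integrable (fun ω => (starRingEnd ℂ) (S.echoDir (pack (θ ω) (α ω)) v i l) *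
      S.echoDir (pack (θ ω) (α ω)) w i l) P := hv.star.integrable_mul hw
  have h := integral_re hi
  simp only [RCLike.re_eq_complex_re] at h
  rw [← h]
  have e : ∀ ω, ((starRingEnd ℂ) (S.echoDir (pack (θ ω) (α ω)) v i l) *
      S.echoDir (pack (θ ω) (α ω)) w i l).re = ∑ r,
      reim (S.echoDir (pack (θ ω) (α ω)) v i l) r *
      reim (S.echoDir (pack (θ ω) (α ω)) w i l) r := by
    intro ω
    simp
  simp only [e]
  rw [integral_finsetSum _ fun r _ => hint r, Finset.mul_sum]
  refine Finset.sum_congr rfl fun r _ => ?_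
  rw [← integral_const_mul, ← integral_const_mul]
  refine integral_congr_ae (ae_of_all _ fun ω => ?_)
  simp only
  field_simp

end IsModel

end SensingSystem

/-! ### Continuous densities of product measures -/

open Filter Topology in
/-- Averages of a density over small cubes converge to the density. -/
theorem tendsto_withDensity_closedBall {ι : Type*} [Fintype ι] {p : (ι → ℝ) → ℝ}
    (hp : Continuous p) (h0 : ∀ x, 0 ≤ p x) (x : ι → ℝ) :
    Tendsto (fun r : ℝ => (volume.withDensity fun t => ENNReal.ofReal (p t)).real
      (Metric.closedBall x r) / (2 * r) ^ Fintype.card ι) (𝓝[>] 0) (𝓝 (p x)) := by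
  have hs : Tendsto (Metric.closedBall x) (𝓝[>] (0 : ℝ)) (𝓝 x).smallSets :=
    (tendsto_closedBall_smallSets x).mono_left nhdsWithin_le_nhds
  have hm : (fun r : ℝ => (volume : Measure (ι → ℝ)).real (Metric.closedBall x r)) =ᶠ[𝓝[>] 0]
      fun r => (2 * r) ^ Fintype.card ι := by
    filter_upwards [self_mem_nhdsWithin] with r hr
    have hr : 0 < r := hr
    rw [Measure.real, Real.volume_pi_closedBall x hr.le, ENNReal.toReal_ofReal (by positivity)]
  -- By continuity at `x`, the mass of a ball is `p x` times its volume up to a smaller order.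
  have h := (hp.continuousAt (x := x)).integral_sub_linear_isLittleO_ae (μ := volume)
    (hp.stronglyMeasurableAtFilter _ _) hs _ hm
  have h2 := h.tendsto_div_nhds_zero.add_const (p x)
  rw [zero_add] at h2
  refine h2.congr' ?_
  filter_upwards [self_mem_nhdsWithin] with r hr
  have hr : 0 < r := hr
  have hr' : (2 * r) ^ Fintype.card ι ≠ 0 := by positivity
  rw [sub_div, smul_eq_mul, mul_div_cancel_left₀ _ hr', sub_add_cancel, Measure.real,
    withDensity_apply _ Metric.isClosed_closedBall.measurableSet,
    integral_eq_lintegral_of_nonneg_ae (ae_of_all _ h0) hp.aestronglyMeasurable]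

open Filter Topology in
/-- A continuous density of a product measure satisfies the exchange identity
of a product function at every point. -/
theorem mul_eq_update_mul_update_of_pi_eq_withDensity {ι : Type*} [Fintype ι] [DecidableEq ι]
    {μ : ι → Measure ℝ} [∀ i, SigmaFinite (μ i)] {p : (ι → ℝ) → ℝ}
    (hp : Continuous p) (h0 : ∀ x, 0 ≤ p x)
    (h : Measure.pi μ = volume.withDensity fun t => ENNReal.ofReal (p t)) (m : ι) (x y : ι → ℝ) :
    p x * p y = p (Function.update x m (y m)) * p (Function.update y m (x m)) := by
  have ht := tendsto_withDensity_closedBall hp h0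
  refine tendsto_nhds_unique ((ht x).mul (ht y)) (((ht (Function.update x m (y m))).mul
    (ht (Function.update y m (x m)))).congr' ?_)
  filter_upwards [self_mem_nhdsWithin] with r hr
  have hr : 0 < r := hr
  -- The mass of a cube is a product over coordinates. Exchanging the `m`-th coordinates of `x` and
  -- `y` only swaps two factors, so both sides agree already for each `r`.
  simp only [← h, Measure.real, Measure.pi_closedBall _ _ hr.le, ENNReal.toReal_prod]
  rw [div_mul_div_comm, div_mul_div_comm, ← Finset.prod_mul_distrib, ← Finset.prod_mul_distrib]
  congr 1
  refine Finset.prod_congr rfl fun k _ => ?_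
  by_cases hk : k = m
  · subst hk
    simp [mul_comm]
  · simp [hk]

theorem hasDerivAt_comp_update {ι : Type*} [Fintype ι] [DecidableEq ι] {p : (ι → ℝ) → ℝ}
    (hp : Differentiable ℝ p) (x : ι → ℝ) (m : ι) :
    HasDerivAt (fun s => p (Function.update x m s)) (fderiv ℝ p x (Pi.single m 1)) (x m) := by
  have h := (hp (Function.update x m (x m))).hasFDerivAt.comp_hasDerivAt (x m)
    (hasDerivAt_update x m (x m))
  rw [Function.update_eq_self] at h
  exact h

/-- The partial logarithmic derivative of a differentiable density of a product measure
depends on one coordinate only. -/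
theorem exists_score_eq_of_pi_eq_withDensity {ι : Type*} [Fintype ι] [DecidableEq ι]
    {μ : ι → Measure ℝ} [∀ i, SigmaFinite (μ i)] {p : (ι → ℝ) → ℝ}
    (hp : Differentiable ℝ p) (h0 : ∀ x, 0 ≤ p x)
    (h : Measure.pi μ = volume.withDensity fun t => ENNReal.ofReal (p t)) (m : ι) :
    ∃ ψ : ℝ → ℝ, Measurable ψ ∧
      ∀ x, p x ≠ 0 → fderiv ℝ p x (Pi.single m 1) / p x = ψ (x m) := by
  by_cases hne : ∃ y, p y ≠ 0
  swap
  · exact ⟨0, measurable_const, fun x hx => absurd ⟨x, hx⟩ hne⟩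
  obtain ⟨y, hy⟩ := hne
  set g : ℝ → ℝ := fun s => p (Function.update y m s) with hg
  have hgc : Continuous g := hp.continuous.comp (continuous_const.update m continuous_id)
  refine ⟨fun s => deriv g s / g s, (measurable_deriv g).div hgc.measurable, fun x hx => ?_⟩
  -- By the exchange identity with reference point `y`, the restriction of `p` to the `m`-line
  -- through `x` is `c * g`, with `g` independent of `x`; the constant `c` cancels in the
  -- logarithmic derivative.
  set c := p (Function.update x m (y m)) / p y with hc
  have hid : (fun s => p (Function.update x m s)) = fun s => c * g s := by
    funext s
    have := mul_eq_update_mul_update_of_pi_eq_withDensity hp.continuous h0 h m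
      (Function.update x m s) y
    simp only [Function.update_idem, Function.update_self] at this
    rw [hc, hg, div_mul_eq_mul_div, eq_div_iff hy, this]
  have h1 := (hasDerivAt_comp_update hp x m).deriv
  have h2 : p x = c * g (x m) := by
    have := congrFun hid (x m)
    simpa using this
  have hc0 : c ≠ 0 := fun h => hx (by rw [h2, h, zero_mul])
  rw [hid, deriv_const_mul_field] at h1
  rw [← h1, h2, mul_div_mul_left _ _ hc0]

/-! ### The entries of `F_O` -/

namespace SensingSystem

variable {M Nt Nr L : ℕ} {S : SensingSystem M Nt Nr L}

theorem coeffs_single_inl (m : Fin M) : coeffs (Pi.single (Sum.inl m) (1 : ℝ)) = 0 := by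
  ext n; apply Complex.ext <;> simp [coeffs]

theorem coeffs_single_inr (q : Fin M × Fin 2) :
    coeffs (Pi.single (Sum.inr q) (1 : ℝ)) =
      Pi.single q.1 (if q.2 = 0 then 1 else Complex.I) := by
  obtain ⟨m, r⟩ := q
  ext n
  by_cases hn : n = m
  · subst hn
    fin_cases r <;> apply Complex.ext <;> simp [coeffs]
  · apply Complex.ext <;> simp [coeffs, hn]

theorem echoDir_inl (θ : Fin M → ℝ) (α : Fin M → ℂ) (m : Fin M) (i : Fin Nr) (l : Fin L) :
    S.echoDir (pack θ α) (Pi.single (Sum.inl m) 1) i l =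
      α m * (S.respDeriv (θ m) * S.X) i l := by
  simp only [echoDir, coeffs_single_inl, angles_pack, coeffs_pack]
  rw [Finset.sum_eq_single m]
  · simp
  · intro n _ hn
    simp [hn]
  · simp

theorem echoDir_inr (θ : Fin M → ℝ) (α : Fin M → ℂ) (q : Fin M × Fin 2) (i : Fin Nr) (l : Fin L) :
    S.echoDir (pack θ α) (Pi.single (Sum.inr q) 1) i l =
      (if q.2 = 0 then 1 else Complex.I) * (S.resp (θ q.1) * S.X) i l := by
  simp only [echoDir, coeffs_single_inr, angles_pack, coeffs_pack]
  rw [Finset.sum_eq_single q.1]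
  · simp
  · intro n _ hn
    simp [hn]
  · simp

namespace IsModel

variable {Ω : Type*} [MeasurableSpace Ω] {P : Measure Ω}
  {θ : Ω → Fin M → ℝ} {α : Ω → Fin M → ℂ} {N : Ω → Obs Nr L}

theorem fimObs_apply (H : S.IsModel P θ α N) (i j : ParamIdx M) :
    S.fimObs P (fun ω => S.received (θ ω) (α ω) (N ω)) (fun ω => pack (θ ω) (α ω)) i j =
      ∫ ω, S.obsDir (S.received (θ ω) (α ω) (N ω)) (pack (θ ω) (α ω)) (Pi.single i 1) *
        S.obsDir (S.received (θ ω) (α ω) (N ω)) (pack (θ ω) (α ω)) (Pi.single j 1) ∂P := by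
  simp only [fimObs, Matrix.of_apply, S.obsScore_eq H.noise_pos H.diff_a H.diff_b]

theorem integral_conj_coeff_mul_mul (H : S.IsModel P θ α N) (m n : Fin M)
    {f g : (Fin M → ℝ) → ℂ} (hf : Measurable f) (hg : Measurable g) :
    ∫ ω, (starRingEnd ℂ) (α ω m * f (θ ω)) * (α ω n * g (θ ω)) ∂P =
      (if m = n then 2 * (S.sigmaAlpha m : ℂ) ^ 2 else 0) *
        ∫ ω, (starRingEnd ℂ) (f (θ ω)) * g (θ ω) ∂P := by
  have hF : Measurable fun t => (starRingEnd ℂ) (f t) * g t := (Complex.continuous_conj.measurable.comp hf).mul hg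
  have hG : Measurable fun a : Fin M → ℂ => (starRingEnd ℂ) (a m) * a n :=
    (Complex.continuous_conj.measurable.comp (measurable_pi_apply m)).mul (measurable_pi_apply n)
  have hind := H.indep_angle_coeff hF hG
  have h := hind.integral_fun_mul_eq_mul_integral
    (hG.comp_aemeasurable H.law_coeffs.aemeasurable).aestronglyMeasurable
    (hF.comp_aemeasurable H.law_angles.aemeasurable).aestronglyMeasurable
  beta_reduce at h
  rw [← H.integral_conj_coeff_mul, ← h]
  refine integral_congr_ae (ae_of_all _ fun ω => ?_)
  simp only [map_mul]
  ring

theorem fimObs_inl_inl (H : S.IsModel P θ α N) (m n : Fin M) :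
    S.fimObs P (fun ω => S.received (θ ω) (α ω) (N ω)) (fun ω => pack (θ ω) (α ω))
      (Sum.inl m) (Sum.inl n) = 2 / S.noiseVar * (∑ i, ∑ l,
        (if m = n then 2 * (S.sigmaAlpha m : ℂ) ^ 2 else 0) *
          ∫ ω, (starRingEnd ℂ) ((S.respDeriv (θ ω m) * S.X) i l) *
            (S.respDeriv (θ ω n) * S.X) i l ∂P).re := by
  rw [H.fimObs_apply, H.integral_obsDir_mul_obsDir]
  simp only [echoDir_inl]
  congr 2
  refine Finset.sum_congr rfl fun i _ => Finset.sum_congr rfl fun l _ => ?_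
  exact H.integral_conj_coeff_mul_mul m n (f := fun t => (S.respDeriv (t m) * S.X) i l)
    (g := fun t => (S.respDeriv (t n) * S.X) i l) (measurable_respDeriv_mul m i l)
    (measurable_respDeriv_mul n i l)

theorem fimObs_inl_inl_of_ne (H : S.IsModel P θ α N) {m n : Fin M} (hmn : m ≠ n) :
    S.fimObs P (fun ω => S.received (θ ω) (α ω) (N ω)) (fun ω => pack (θ ω) (α ω))
      (Sum.inl m) (Sum.inl n) = 0 := by
  simp [H.fimObs_inl_inl, hmn]

/-- The derivative of the echo in an angle is linear in `α_m`, the derivative in a coefficient is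
free of `α`. Their Hermitian product thus has a factor `conj α_m`, of mean zero and independent of
`θ`. -/
theorem fimObs_inl_inr (H : S.IsModel P θ α N) (m : Fin M) (q : Fin M × Fin 2) :
    S.fimObs P (fun ω => S.received (θ ω) (α ω) (N ω)) (fun ω => pack (θ ω) (α ω))
      (Sum.inl m) (Sum.inr q) = 0 := by
  rw [H.fimObs_apply, H.integral_obsDir_mul_obsDir]
  simp only [echoDir_inl, echoDir_inr]
  have h : ∀ i l, ∫ ω, (starRingEnd ℂ) (α ω m * (S.respDeriv (θ ω m) * S.X) i l) *
      ((if q.2 = 0 then 1 else Complex.I) * (S.resp (θ ω q.1) * S.X) i l) ∂P = 0 := by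
    intro i l
    set c : ℂ := if q.2 = 0 then 1 else Complex.I
    have hF : Measurable fun t : Fin M → ℝ => (starRingEnd ℂ) ((S.respDeriv (t m) * S.X) i l) *
        (c * (S.resp (t q.1) * S.X) i l) :=
      (Complex.continuous_conj.measurable.comp (measurable_respDeriv_mul m i l)).mul
        ((H.measurable_resp_mul q.1 i l).const_mul _)
    have hG : Measurable fun a : Fin M → ℂ => (starRingEnd ℂ) (a m) :=
      Complex.continuous_conj.measurable.comp (measurable_pi_apply m)
    have h := (H.indep_angle_coeff hF hG).integral_fun_mul_eq_mul_integral
      (hG.comp_aemeasurable H.law_coeffs.aemeasurable).aestronglyMeasurable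
      (hF.comp_aemeasurable H.law_angles.aemeasurable).aestronglyMeasurable
    beta_reduce at h
    rw [integral_conj, H.integral_coeff, map_zero, zero_mul] at h
    rw [← h]
    refine integral_congr_ae (ae_of_all _ fun ω => ?_)
    simp only [map_mul]
    ring
  simp only [h]
  simp

/-- Cyclicity of the trace turns `tr(Dᴴ D X Xᴴ)` into the squared Frobenius norm of `D X`, here
under the expectation. -/
theorem trace_Amat_mul (H : S.IsModel P θ α N) (m : Fin M) :
    (S.Amat P θ m * (S.X * S.Xᴴ)).trace = ∑ i, ∑ l,
      ∫ ω, (starRingEnd ℂ) ((S.respDeriv (θ ω m) * S.X) i l) *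
        (S.respDeriv (θ ω m) * S.X) i l ∂P := by
  have hint : ∀ j k, Integrable (fun ω => ((S.respDeriv (θ ω m))ᴴ * S.respDeriv (θ ω m)) j k) P := by
    intro j k
    simp only [Matrix.mul_apply, Matrix.conjTranspose_apply]
    exact integrable_finsetSum _ fun i _ =>
      (H.memLp_respDeriv m i j).star.integrable_mul (H.memLp_respDeriv m i k)
  have h1 : (S.Amat P θ m * (S.X * S.Xᴴ)).trace =
      ∫ ω, ((S.respDeriv (θ ω m))ᴴ * S.respDeriv (θ ω m) * (S.X * S.Xᴴ)).trace ∂P := by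
    simp only [Matrix.trace, Matrix.diag_apply]
    simp only [Matrix.mul_apply (N := S.X * S.Xᴴ), Amat, Matrix.of_apply]
    rw [integral_finsetSum _ fun j _ => integrable_finsetSum _ fun k _ => (hint j k).mul_const _]
    refine Finset.sum_congr rfl fun j _ => ?_
    rw [integral_finsetSum _ fun k _ => (hint j k).mul_const _]
    refine Finset.sum_congr rfl fun k _ => ?_
    rw [integral_mul_const]
  have h2 : ∀ D : Matrix (Fin Nr) (Fin Nt) ℂ, (Dᴴ * D * (S.X * S.Xᴴ)).trace =
      ∑ i, ∑ l, (starRingEnd ℂ) ((D * S.X) i l) * (D * S.X) i l := by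
    intro D
    rw [← Matrix.mul_assoc, Matrix.trace_mul_comm, ← Matrix.mul_assoc, ← Matrix.mul_assoc,
      ← Matrix.conjTranspose_mul, Matrix.mul_assoc, Matrix.trace, Finset.sum_comm]
    simp only [Matrix.diag_apply, Matrix.mul_apply (M := (D * S.X)ᴴ), Matrix.conjTranspose_apply]
    rfl
  rw [h1]
  simp only [h2]
  have hD : ∀ i l, Integrable (fun ω => (starRingEnd ℂ) ((S.respDeriv (θ ω m) * S.X) i l) *
      (S.respDeriv (θ ω m) * S.X) i l) P := fun i l =>
    (H.memLp_respDeriv_mul m i l).star.integrable_mul (H.memLp_respDeriv_mul m i l)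
  rw [integral_finsetSum _ fun i _ => integrable_finsetSum _ fun l _ => hD i l]
  refine Finset.sum_congr rfl fun i _ => ?_
  rw [integral_finsetSum _ fun l _ => hD i l]

theorem mul_trace_Amat_mul_RX (H : S.IsModel P θ α N) (m : Fin M) :
    (L : ℂ) * (S.Amat P θ m * S.RX).trace = ∑ i, ∑ l,
      ∫ ω, (starRingEnd ℂ) ((S.respDeriv (θ ω m) * S.X) i l) *
        (S.respDeriv (θ ω m) * S.X) i l ∂P := by
  rw [← H.trace_Amat_mul m, RX, Matrix.mul_smul, Matrix.trace_smul, smul_eq_mul]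
  -- For `L = 0` the factor `L⁻¹` cannot be cancelled, but `X Xᴴ` is an empty sum and both sides
  -- vanish.
  rcases Nat.eq_zero_or_pos L with hL | hL
  · subst hL
    have : S.X * S.Xᴴ = 0 := by ext; simp [Matrix.mul_apply]
    simp [this]
  · rw [← mul_assoc, mul_inv_cancel₀ (by exact_mod_cast hL.ne'), one_mul]

theorem fimObs_inl_self (H : S.IsModel P θ α N) (m : Fin M) :
    (S.fimObs P (fun ω => S.received (θ ω) (α ω) (N ω)) (fun ω => pack (θ ω) (α ω))
      (Sum.inl m) (Sum.inl m) : ℂ) = (S.beta m : ℂ) * (S.Amat P θ m * S.RX).trace := by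
  -- A sum of squared moduli is real, so the real part in `fimObs_inl_inl` loses nothing and the
  -- identity holds in `ℂ`.
  have hreal : ∑ i, ∑ l, ∫ ω, (starRingEnd ℂ) ((S.respDeriv (θ ω m) * S.X) i l) *
      (S.respDeriv (θ ω m) * S.X) i l ∂P =
      ((∑ i, ∑ l, ∫ ω, Complex.normSq ((S.respDeriv (θ ω m) * S.X) i l) ∂P : ℝ) : ℂ) := by
    simp only [Complex.ofReal_sum, ← integral_complex_ofReal, Complex.normSq_eq_conj_mul_self]
  rw [H.fimObs_inl_inl]
  simp only [if_true, ← Finset.mul_sum]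
  have h := H.mul_trace_Amat_mul_RX m
  rw [hreal] at h ⊢
  rw [show (S.beta m : ℂ) * (S.Amat P θ m * S.RX).trace = 4 * (S.sigmaAlpha m : ℂ) ^ 2 /
    S.noiseVar * (L * (S.Amat P θ m * S.RX).trace) by simp [beta]; ring, h]
  set R := ∑ i, ∑ l, ∫ ω, Complex.normSq ((S.respDeriv (θ ω m) * S.X) i l) ∂P
  have e : 2 * (S.sigmaAlpha m : ℂ) ^ 2 * (R : ℂ) = ((2 * S.sigmaAlpha m ^ 2 * R : ℝ) : ℂ) := by
    push_cast; ring
  rw [e, Complex.ofReal_re]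
  push_cast
  ring

end IsModel

end SensingSystem

/-! ### The information inequality -/

section InformationInequality

variable {Ω I : Type*} [MeasurableSpace Ω] {P : Measure Ω} [Fintype I] {s : I → Ω → ℝ}

theorem memLp_linear_combination (hs : ∀ i, MemLp (s i) 2 P) (c : I → ℝ) :
    MemLp (fun ω => ∑ i, c i * s i ω) 2 P :=
  memLp_finsetSum _ fun i _ => (hs i).const_mul _

theorem integral_mul_linear_combination {e : Ω → ℝ} (he : MemLp e 2 P)
    (hs : ∀ i, MemLp (s i) 2 P) (c : I → ℝ) :
    ∫ ω, e ω * ∑ i, c i * s i ω ∂P = ∑ i, c i * ∫ ω, e ω * s i ω ∂P := by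
  simp only [Finset.mul_sum, mul_left_comm (e _)]
  have h : ∀ i, Integrable (fun ω => c i * (e ω * s i ω)) P := fun i =>
    (he.integrable_mul (hs i)).const_mul _
  rw [integral_finsetSum _ fun i _ => h i]
  simp only [integral_const_mul]

theorem integral_sq_linear_combination {F : Matrix I I ℝ} (hs : ∀ i, MemLp (s i) 2 P)
    (hF : ∀ i j, F i j = ∫ ω, s i ω * s j ω ∂P) (c : I → ℝ) :
    ∫ ω, (∑ i, c i * s i ω) ^ 2 ∂P = c ⬝ᵥ (F *ᵥ c) := by
  simp only [pow_two]
  rw [integral_mul_linear_combination (memLp_linear_combination hs c) hs c]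
  simp only [dotProduct, Matrix.mulVec]
  refine Finset.sum_congr rfl fun i _ => ?_
  congr 1
  have h := integral_mul_linear_combination (hs i) hs c
  simp only [mul_comm (∑ i, c i * s i _)]
  rw [h]
  exact Finset.sum_congr rfl fun j _ => by rw [hF, mul_comm]

/-- The information inequality: a square integrable error `e` with correlations `x` with the
scores `s`. -/
theorem dotProduct_inv_mulVec_le_integral_sq [DecidableEq I] {F : Matrix I I ℝ} (hdet : IsUnit F.det)
    (hs : ∀ i, MemLp (s i) 2 P) (hF : ∀ i j, F i j = ∫ ω, s i ω * s j ω ∂P)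
    {e : Ω → ℝ} (he : MemLp e 2 P) {x : I → ℝ} (hx : ∀ i, ∫ ω, e ω * s i ω ∂P = x i) :
    x ⬝ᵥ (F⁻¹ *ᵥ x) ≤ ∫ ω, e ω ^ 2 ∂P := by
  -- These are the coefficients of the orthogonal projection of `e` onto the span of the scores; the
  -- claim is that the residual has nonnegative second moment.
  set c := F⁻¹ *ᵥ x with hc
  have hFc : F *ᵥ c = x := by
    rw [hc, Matrix.mulVec_mulVec, Matrix.mul_nonsing_inv _ hdet, Matrix.one_mulVec]
  have hl := memLp_linear_combination hs c
  have h0 : 0 ≤ ∫ ω, (e ω - ∑ i, c i * s i ω) ^ 2 ∂P := integral_nonneg fun ω => sq_nonneg _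
  have hexp : ∫ ω, (e ω - ∑ i, c i * s i ω) ^ 2 ∂P =
      ∫ ω, e ω ^ 2 ∂P - 2 * ∫ ω, e ω * ∑ i, c i * s i ω ∂P + ∫ ω, (∑ i, c i * s i ω) ^ 2 ∂P := by
    have i1 := he.integrable_sq
    have i2 := (he.integrable_mul hl).const_mul 2
    have i3 := hl.integrable_sq
    simp only [Pi.mul_apply] at i2
    rw [← integral_const_mul, ← integral_sub' i1 i2, ← integral_add' (i1.sub i2) i3]
    refine integral_congr_ae (ae_of_all _ fun ω => ?_)
    simp only [Pi.sub_apply, Pi.add_apply]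
    ring
  rw [hexp, integral_sq_linear_combination hs hF, integral_mul_linear_combination he hs, hFc] at h0
  have h1 : ∑ i, c i * ∫ ω, e ω * s i ω ∂P = x ⬝ᵥ c := by
    simp only [hx, dotProduct]
    exact Finset.sum_congr rfl fun i _ => mul_comm _ _
  rw [h1, dotProduct_comm c x] at h0
  linarith

/-- The information inequality with a single score; it produces the bound by the reciprocal of a
diagonal entry of `F`. -/
theorem inv_le_integral_sq {s e : Ω → ℝ} (hs : MemLp s 2 P) (he : MemLp e 2 P)
    (h : ∫ ω, e ω * s ω ∂P = 1) (hpos : 0 < ∫ ω, s ω * s ω ∂P) :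
    (∫ ω, s ω * s ω ∂P)⁻¹ ≤ ∫ ω, e ω ^ 2 ∂P := by
  have := dotProduct_inv_mulVec_le_integral_sq (I := Unit) (s := fun _ => s)
    (F := Matrix.of fun _ _ => ∫ ω, s ω * s ω ∂P) (by simpa using hpos.ne') (fun _ => hs)
    (fun _ _ => rfl) he (x := fun _ => 1) (fun _ => h)
  simpa [dotProduct, Matrix.mulVec, Matrix.inv_def, Ring.inverse_eq_inv'] using this

/-- The third product is commuted so that in both cross terms the observation score comes first, as
in `integral_obsDir_mul`. -/
theorem integral_add_mul_add {a b c d : Ω → ℝ} (ha : MemLp a 2 P) (hb : MemLp b 2 P)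
    (hc : MemLp c 2 P) (hd : MemLp d 2 P) :
    ∫ ω, (a ω + b ω) * (c ω + d ω) ∂P = ∫ ω, a ω * c ω ∂P + ∫ ω, a ω * d ω ∂P +
      ∫ ω, c ω * b ω ∂P + ∫ ω, b ω * d ω ∂P := by
  have i1 : Integrable (fun ω => a ω * c ω) P := ha.integrable_mul hc
  have i2 : Integrable (fun ω => a ω * d ω) P := ha.integrable_mul hd
  have i3 : Integrable (fun ω => c ω * b ω) P := hc.integrable_mul hb
  have i4 : Integrable (fun ω => b ω * d ω) P := hb.integrable_mul hd
  rw [← integral_add' i1 i2, ← integral_add' (i1.add i2) i3, ← integral_add' ((i1.add i2).add i3) i4]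
  refine integral_congr_ae (ae_of_all _ fun ω => ?_)
  simp only [Pi.add_apply]
  ring

end InformationInequality

/-! ### The Bayesian Fisher information matrix -/

namespace SensingSystem

variable {M Nt Nr L : ℕ} {S : SensingSystem M Nt Nr L}

namespace IsModel

variable {Ω : Type*} [MeasurableSpace Ω] {P : Measure Ω}
  {θ : Ω → Fin M → ℝ} {α : Ω → Fin M → ℂ} {N : Ω → Obs Nr L}

/-- Where the prior vanishes, the logarithmic derivative has no meaning as a score. The angles
almost surely avoid this set, so scores may be replaced by the explicit `priorDir`. -/
theorem ae_prior_ne_zero (H : S.IsModel P θ α N) : ∀ᵐ ω ∂P, S.prior (θ ω) ≠ 0 := by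
  have hm : Measurable S.prior := H.prior_diff.continuous.measurable
  have h : ∀ᵐ t ∂(volume.withDensity fun t => ENNReal.ofReal (S.prior t)), S.prior t ≠ 0 := by
    rw [ae_withDensity_iff hm.ennreal_ofReal]
    refine ae_of_all _ fun t ht h0 => ht (by simp [h0])
  rw [← H.law_angles.map_eq] at h
  exact ae_of_ae_map H.law_angles.aemeasurable h

theorem lineDeriv_log_prior (H : S.IsModel P θ α N) {t : Fin M → ℝ} (ht : S.prior t ≠ 0)
    (v : Fin M → ℝ) :
    lineDeriv ℝ (fun t => Real.log (S.prior t)) t v = fderiv ℝ S.prior t v / S.prior t :=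
  (HasLineDerivAt.log_of_mul ht
    (hasLineDerivAt_div_mul_self H.prior_diff H.prior_nonneg t v)).lineDeriv

theorem measurable_angleScore (H : S.IsModel P θ α N) (v : Fin M → ℝ) :
    Measurable fun t => fderiv ℝ S.prior t v / S.prior t :=
  (measurable_fderiv_apply_const ℝ S.prior v).div H.prior_diff.continuous.measurable

theorem memLp_angleScore (H : S.IsModel P θ α N) (m : Fin M) :
    MemLp (fun ω => fderiv ℝ S.prior (θ ω) (Pi.single m 1) / S.prior (θ ω)) 2 P := by
  have hm : AEStronglyMeasurable
      (fun ω => fderiv ℝ S.prior (θ ω) (Pi.single m 1) / S.prior (θ ω)) P :=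
    ((H.measurable_angleScore (Pi.single m 1)).comp_aemeasurable
      H.law_angles.aemeasurable).aestronglyMeasurable
  rw [memLp_two_iff_integrable_sq hm]
  refine (H.integrable_score_sq m).congr ?_
  filter_upwards [H.ae_prior_ne_zero] with ω hω
  rw [H.lineDeriv_log_prior hω]

theorem memLp_priorDir (H : S.IsModel P θ α N) (i : ParamIdx M) :
    MemLp (fun ω => S.priorDir (pack (θ ω) (α ω)) (Pi.single i 1)) 2 P := by
  rcases i with m | q
  · simp only [priorDir_inl, angles_pack]
    exact H.memLp_angleScore m
  · simp only [priorDir_inr, pack_inr, div_eq_mul_inv]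
    exact ((memLp_complex_reim (H.memLp_coeff q.1) q.2).mul_const _).neg

/-- The score of the joint density. -/
noncomputable def totalScore (S : SensingSystem M Nt Nr L) (θ : Ω → Fin M → ℝ) (α : Ω → Fin M → ℂ)
    (N : Ω → Obs Nr L) (i : ParamIdx M) (ω : Ω) : ℝ :=
  S.obsDir (S.received (θ ω) (α ω) (N ω)) (pack (θ ω) (α ω)) (Pi.single i 1) +
    S.priorDir (pack (θ ω) (α ω)) (Pi.single i 1)

theorem memLp_totalScore (H : S.IsModel P θ α N) (i : ParamIdx M) :
    MemLp (totalScore S θ α N i) 2 P :=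
  (H.memLp_obsDir _).add (H.memLp_priorDir i)

theorem priorScore_ae_eq (H : S.IsModel P θ α N) (i : ParamIdx M) :
    (fun ω => S.priorScore i (pack (θ ω) (α ω))) =ᵐ[P]
      fun ω => S.priorDir (pack (θ ω) (α ω)) (Pi.single i 1) := by
  filter_upwards [H.ae_prior_ne_zero] with ω hω
  exact S.priorScore_eq H.sigma_pos H.prior_nonneg H.prior_diff i hω

theorem jointScore_ae_eq (H : S.IsModel P θ α N) (i : ParamIdx M) :
    (fun ω => S.jointScore i (S.received (θ ω) (α ω) (N ω)) (pack (θ ω) (α ω))) =ᵐ[P]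
      totalScore S θ α N i := by
  filter_upwards [H.ae_prior_ne_zero] with ω hω
  exact S.jointScore_eq H.noise_pos H.sigma_pos H.diff_a H.diff_b H.prior_nonneg H.prior_diff i _ hω

theorem fimPrior_apply (H : S.IsModel P θ α N) (i j : ParamIdx M) :
    S.fimPrior P (fun ω => pack (θ ω) (α ω)) i j =
      ∫ ω, S.priorDir (pack (θ ω) (α ω)) (Pi.single i 1) *
        S.priorDir (pack (θ ω) (α ω)) (Pi.single j 1) ∂P :=
  integral_congr_ae ((H.priorScore_ae_eq i).mul (H.priorScore_ae_eq j))

theorem fim_apply (H : S.IsModel P θ α N) (i j : ParamIdx M) :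
    S.fim P (fun ω => S.received (θ ω) (α ω) (N ω)) (fun ω => pack (θ ω) (α ω)) i j =
      ∫ ω, totalScore S θ α N i ω * totalScore S θ α N j ω ∂P :=
  integral_congr_ae ((H.jointScore_ae_eq i).mul (H.jointScore_ae_eq j))

theorem fim_eq_add (H : S.IsModel P θ α N) :
    S.fim P (fun ω => S.received (θ ω) (α ω) (N ω)) (fun ω => pack (θ ω) (α ω)) =
      S.fimObs P (fun ω => S.received (θ ω) (α ω) (N ω)) (fun ω => pack (θ ω) (α ω)) +
        S.fimPrior P (fun ω => pack (θ ω) (α ω)) := by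
  ext i j
  have hO := fun i : ParamIdx M => H.memLp_obsDir (Pi.single i 1)
  have hP := H.memLp_priorDir
  have c1 := H.integral_obsDir_mul (Pi.single i 1) (measurable_priorDir H.prior_diff _) (hP j)
  have c2 := H.integral_obsDir_mul (Pi.single j 1) (measurable_priorDir H.prior_diff _) (hP i)
  rw [Matrix.add_apply, H.fim_apply, H.fimObs_apply, H.fimPrior_apply]
  simp only [totalScore]
  rw [integral_add_mul_add (hO i) (hP i) (hO j) (hP j), c1, c2]
  ring

theorem hasLaw_joint (H : S.IsModel P θ α N) :
    HasLaw (fun ω => (pack (θ ω) (α ω), S.received (θ ω) (α ω) (N ω)))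
      (volume.withDensity fun z : (ParamIdx M → ℝ) × Obs Nr L =>
        ENNReal.ofReal (S.condPDF z.2 z.1 * S.paramPDF z.1)) P := by
  have := H.isProbabilityMeasure
  exact S.hasLaw_param_received H.noise_pos H.sigma_pos H.diff_a H.diff_b H.prior_nonneg
    H.prior_diff.continuous.measurable H.law_angles H.law_coeffs H.law_noise
    H.indep_angles_coeffs H.indep_noise

/-- Used for three test functions: the estimation error, the constant `1`, and `arctan` of a
parameter. Square integrability of `φ` and of the score gives the integrability of their product. -/
theorem integral_mul_totalScore (H : S.IsModel P θ α N) (j : ParamIdx M)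
    {φ φ' : (ParamIdx M → ℝ) × Obs Nr L → ℝ} (hφ : Measurable φ) (hφ' : Measurable φ')
    (hφφ' : ∀ x y, HasLineDerivAt ℝ (fun z => φ (z, y)) (φ' (x, y)) x (Pi.single j 1))
    (hφ2 : MemLp (fun ω => φ (pack (θ ω) (α ω), S.received (θ ω) (α ω) (N ω))) 2 P)
    (hiφ' : Integrable (fun ω => φ' (pack (θ ω) (α ω), S.received (θ ω) (α ω) (N ω))) P) :
    ∫ ω, φ (pack (θ ω) (α ω), S.received (θ ω) (α ω) (N ω)) * totalScore S θ α N j ω ∂P =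
      -∫ ω, φ' (pack (θ ω) (α ω), S.received (θ ω) (α ω) (N ω)) ∂P := by
  have := H.isProbabilityMeasure
  exact integral_mul_score_eq_neg (X := fun ω => pack (θ ω) (α ω))
    (Y := fun ω => S.received (θ ω) (α ω) (N ω))
    (q := fun z => S.condPDF z.2 z.1 * S.paramPDF z.1)
    (T := fun z => S.obsDir z.2 z.1 (Pi.single j 1) + S.priorDir z.1 (Pi.single j 1))
    ((S.measurable_condPDF H.diff_a H.diff_b).mul
      ((S.measurable_paramPDF H.prior_diff.continuous.measurable).comp measurable_fst))
    (fun z => mul_nonneg (S.condPDF_pos H.noise_pos _ _).le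
      (S.paramPDF_nonneg H.sigma_pos H.prior_nonneg _))
    H.hasLaw_joint
    ((measurable_obsDir H.diff_a H.diff_b _).add
      ((measurable_priorDir H.prior_diff _).comp measurable_fst))
    hφ hφ'
    (fun x y => S.hasLineDerivAt_joint H.noise_pos H.sigma_pos H.diff_a H.diff_b H.prior_nonneg
      H.prior_diff y x _)
    hφφ' (hφ2.integrable one_le_two) hiφ' (hφ2.integrable_mul (H.memLp_totalScore j))

theorem aemeasurable_param (H : S.IsModel P θ α N) :
    AEMeasurable (fun ω => pack (θ ω) (α ω)) P :=
  measurable_fst.comp_aemeasurable H.hasLaw_joint.aemeasurable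

theorem integral_error_mul_totalScore (H : S.IsModel P θ α N) (i j : ParamIdx M)
    {g : Obs Nr L → ℝ} (hg : Measurable g)
    (hg2 : MemLp (fun ω => g (S.received (θ ω) (α ω) (N ω)) - pack (θ ω) (α ω) i) 2 P) :
    ∫ ω, (g (S.received (θ ω) (α ω) (N ω)) - pack (θ ω) (α ω) i) * totalScore S θ α N j ω ∂P =
      (Pi.single i 1 : ParamIdx M → ℝ) j := by
  have := H.isProbabilityMeasure
  have h := H.integral_mul_totalScore j (φ := fun z => g z.2 - z.1 i)
    (φ' := fun _ => -(Pi.single j 1 : ParamIdx M → ℝ) i)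
    ((hg.comp measurable_snd).sub (by fun_prop)) measurable_const
    (fun x y => (hasDerivAt_coord x (Pi.single j 1) i).const_sub (g y)) hg2
    (integrable_const _)
  rw [h]
  simp [Pi.single_apply, eq_comm]

theorem integral_totalScore (H : S.IsModel P θ α N) (j : ParamIdx M) :
    ∫ ω, totalScore S θ α N j ω ∂P = 0 := by
  have := H.isProbabilityMeasure
  have h := H.integral_mul_totalScore j (φ := fun _ => 1) (φ' := fun _ => 0)
    measurable_const measurable_const (fun x y => hasDerivAt_const _ _) (memLp_const _)
    (integrable_const _)
  simpa using h

/-- The test function for positive definiteness must be bounded with bounded, strictly positive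
derivative: the angles themselves need not have finite moments. -/
theorem memLp_arctan_param (H : S.IsModel P θ α N) (i : ParamIdx M) :
    MemLp (fun ω => Real.arctan (pack (θ ω) (α ω) i)) 2 P := by
  have := H.isProbabilityMeasure
  have hm := H.aemeasurable_param
  refine MemLp.of_bound ?_ (Real.pi / 2) (ae_of_all _ fun ω => ?_)
  · exact AEMeasurable.aestronglyMeasurable
      (Real.measurable_arctan.comp_aemeasurable (by fun_prop))
  · exact (abs_lt.2 ⟨Real.neg_pi_div_two_lt_arctan _, Real.arctan_lt_pi_div_two _⟩).le

theorem integrable_one_div_one_add_sq (H : S.IsModel P θ α N) (i : ParamIdx M) :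
    Integrable (fun ω => 1 / (1 + (pack (θ ω) (α ω) i) ^ 2)) P := by
  have := H.isProbabilityMeasure
  have hm := H.aemeasurable_param
  refine Integrable.of_bound (C := 1) ?_ (ae_of_all _ fun ω => ?_)
  · exact AEMeasurable.aestronglyMeasurable (by fun_prop)
  · rw [Real.norm_of_nonneg (by positivity)]
    exact div_le_one_of_le₀ (by nlinarith [sq_nonneg (pack (θ ω) (α ω) i)]) (by positivity)

theorem integral_arctan_mul_totalScore (H : S.IsModel P θ α N) (i j : ParamIdx M) :
    ∫ ω, Real.arctan (pack (θ ω) (α ω) i) * totalScore S θ α N j ω ∂P =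
      -((Pi.single j 1 : ParamIdx M → ℝ) i * ∫ ω, 1 / (1 + (pack (θ ω) (α ω) i) ^ 2) ∂P) := by
  have := H.isProbabilityMeasure
  have hb := H.integrable_one_div_one_add_sq i
  have h := H.integral_mul_totalScore j (φ := fun z => Real.arctan (z.1 i))
    (φ' := fun z => 1 / (1 + (z.1 i) ^ 2) * (Pi.single j 1 : ParamIdx M → ℝ) i)
    (Real.measurable_arctan.comp (by fun_prop)) (by fun_prop)
    (fun x y => by
      have := (hasDerivAt_coord x (Pi.single j 1) i).arctan
      simp only [zero_smul, add_zero] at this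
      exact this) (H.memLp_arctan_param i) (hb.mul_const _)
  rw [h, integral_mul_const, mul_comm]

/-- If `xᵀ F x = 0`, then `∑ x_j s_j = 0` almost surely. Multiplying by `arctan ζ_i` and integrating
leaves `x_i E[1 / (1 + ζ_i²)] = 0`, where the expectation is positive. -/
theorem fim_posDef (H : S.IsModel P θ α N) :
    (S.fim P (fun ω => S.received (θ ω) (α ω) (N ω)) (fun ω => pack (θ ω) (α ω))).PosDef := by
  have := H.isProbabilityMeasure
  have hs := H.memLp_totalScore
  refine Matrix.PosDef.of_dotProduct_mulVec_pos ?_ fun x hx => ?_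
  · ext i j
    simp only [Matrix.conjTranspose_apply, star_trivial, H.fim_apply, mul_comm]
  rw [star_trivial, ← integral_sq_linear_combination hs H.fim_apply]
  have hl := memLp_linear_combination hs x
  refine lt_of_le_of_ne (integral_nonneg fun ω => sq_nonneg _) fun h0 => hx ?_
  have hz := (integral_eq_zero_iff_of_nonneg (fun ω => sq_nonneg _) hl.integrable_sq).1 h0.symm
  funext i
  have h1 := integral_mul_linear_combination (H.memLp_arctan_param i) hs x
  have h2 : ∫ ω, Real.arctan (pack (θ ω) (α ω) i) * ∑ j, x j * totalScore S θ α N j ω ∂P = 0 := by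
    refine integral_eq_zero_of_ae ?_
    filter_upwards [hz] with ω hω
    have : ∑ j, x j * totalScore S θ α N j ω = 0 := by simpa using hω
    simp [this]
  rw [h2] at h1
  simp only [H.integral_arctan_mul_totalScore] at h1
  have hpos : 0 < ∫ ω, 1 / (1 + (pack (θ ω) (α ω) i) ^ 2) ∂P := by
    rw [integral_pos_iff_support_of_nonneg (fun ω => by positivity)
      (H.integrable_one_div_one_add_sq i)]
    have : (Function.support fun ω => 1 / (1 + (pack (θ ω) (α ω) i) ^ 2)) = Set.univ := by
      ext ω
      simp only [Function.mem_support, Set.mem_univ, iff_true]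
      positivity
    rw [this]
    simp
  rw [Finset.sum_eq_single i] at h1
  · have h3 : x i * ∫ ω, 1 / (1 + (pack (θ ω) (α ω) i) ^ 2) ∂P = 0 := by
      simpa using h1
    exact (mul_eq_zero.1 h3).resolve_right hpos.ne'
  · intro j _ hj
    simp [hj.symm]
  · simp

end IsModel

end SensingSystem

/-! ### Lower bounds on the MSE and the case of independent angles -/

/-- Removes the moment assumption on the estimator: an error outside `L²` makes the right-hand side
infinite. -/
theorem ofReal_le_lintegral_sq {Ω : Type*} [MeasurableSpace Ω] {P : Measure Ω} {e : Ω → ℝ} {c : ℝ}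
    (he : AEStronglyMeasurable e P) (h : MemLp e 2 P → c ≤ ∫ ω, e ω ^ 2 ∂P) :
    ENNReal.ofReal c ≤ ∫⁻ ω, ENNReal.ofReal (e ω ^ 2) ∂P := by
  by_cases htop : ∫⁻ ω, ENNReal.ofReal (e ω ^ 2) ∂P = ∞
  · rw [htop]; exact le_top
  have hi : Integrable (fun ω => e ω ^ 2) P :=
    ⟨he.pow 2, (hasFiniteIntegral_iff_ofReal (ae_of_all _ fun ω => sq_nonneg _)).2
      (lt_top_iff_ne_top.2 htop)⟩
  rw [← ofReal_integral_eq_lintegral_ofReal hi (ae_of_all _ fun ω => sq_nonneg _)]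
  exact ENNReal.ofReal_le_ofReal (h ((memLp_two_iff_integrable_sq he).2 hi))

theorem Matrix.inv_apply_self_of_row_eq_zero {n K : Type*} [Fintype n] [DecidableEq n] [Field K]
    {A : Matrix n n K} (hA : IsUnit A.det) {i : n} (h : ∀ j, j ≠ i → A i j = 0) :
    A⁻¹ i i = (A i i)⁻¹ := by
  have h1 := congrFun (congrFun (Matrix.mul_nonsing_inv A hA) i) i
  rw [Matrix.mul_apply, Finset.sum_eq_single i (fun j _ hj => by rw [h j hj, zero_mul])
    (fun hi => absurd (Finset.mem_univ i) hi), Matrix.one_apply_eq] at h1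
  exact eq_inv_of_mul_eq_one_right h1

namespace SensingSystem

variable {M Nt Nr L : ℕ} {S : SensingSystem M Nt Nr L}

namespace IsModel

variable {Ω : Type*} [MeasurableSpace Ω] {P : Measure Ω}
  {θ : Ω → Fin M → ℝ} {α : Ω → Fin M → ℂ} {N : Ω → Obs Nr L}

/-- Both the total score and the observation score have mean zero, hence so does their difference.
-/
theorem integral_priorDir (H : S.IsModel P θ α N) (i : ParamIdx M) :
    ∫ ω, S.priorDir (pack (θ ω) (α ω)) (Pi.single i 1) ∂P = 0 := by
  have := H.isProbabilityMeasure
  have h := H.integral_totalScore i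
  have h1 := H.integral_obsDir_mul (Pi.single i 1) (h := fun _ => 1) measurable_const
    (memLp_const _)
  simp only [mul_one] at h1
  simp only [totalScore] at h
  rw [integral_add ((H.memLp_obsDir _).integrable one_le_two)
    ((H.memLp_priorDir i).integrable one_le_two), h1, zero_add] at h
  exact h

/-- Independence makes the prior a density of a product measure, so the two scores are almost surely
functions of `θ_m` and of `θ_n` alone. They are independent, and each has mean zero. -/
theorem fimPrior_inl_inl_of_ne (H : S.IsModel P θ α N) (hind : iIndepFun (fun m ω => θ ω m) P)
    {m n : Fin M} (hmn : m ≠ n) :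
    S.fimPrior P (fun ω => pack (θ ω) (α ω)) (Sum.inl m) (Sum.inl n) = 0 := by
  have := H.isProbabilityMeasure
  have hθ : ∀ k, AEMeasurable (fun ω => θ ω k) P := fun k =>
    (measurable_pi_apply k).comp_aemeasurable H.law_angles.aemeasurable
  have hprob : ∀ k, IsProbabilityMeasure (P.map fun ω => θ ω k) := fun k =>
    Measure.isProbabilityMeasure_map (hθ k)
  have hpi : Measure.pi (fun k => P.map fun ω => θ ω k) =
      volume.withDensity fun t => ENNReal.ofReal (S.prior t) := by
    rw [← H.law_angles.map_eq, ← (hind.hasLaw_pi fun k => ⟨hθ k, rfl⟩).map_eq]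
  have key : ∀ k, ∃ ψ : ℝ → ℝ, Measurable ψ ∧
      (fun ω => S.priorDir (pack (θ ω) (α ω)) (Pi.single (Sum.inl k) 1)) =ᵐ[P]
        fun ω => ψ (θ ω k) := by
    intro k
    obtain ⟨ψ, hψ, h⟩ := exists_score_eq_of_pi_eq_withDensity H.prior_diff H.prior_nonneg hpi k
    refine ⟨ψ, hψ, ?_⟩
    filter_upwards [H.ae_prior_ne_zero] with ω hω
    rw [priorDir_inl]
    exact h _ hω
  obtain ⟨ψ, hψ, eψ⟩ := key m
  obtain ⟨χ, hχ, eχ⟩ := key n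
  have h := ((hind.indepFun hmn).comp hψ hχ).integral_fun_mul_eq_mul_integral
    (hψ.comp_aemeasurable (hθ m)).aestronglyMeasurable
    (hχ.comp_aemeasurable (hθ n)).aestronglyMeasurable
  simp only [Function.comp_apply] at h
  have h2 : S.fimPrior P (fun ω => pack (θ ω) (α ω)) (Sum.inl m) (Sum.inl n) =
      ∫ ω, ψ (θ ω m) * χ (θ ω n) ∂P :=
    (H.fimPrior_apply _ _).trans (integral_congr_ae (eψ.mul eχ))
  rw [h2, h, ← integral_congr_ae eψ, H.integral_priorDir, zero_mul]

theorem fimPrior_inl_inr (H : S.IsModel P θ α N) (m : Fin M) (q : Fin M × Fin 2) :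
    S.fimPrior P (fun ω => pack (θ ω) (α ω)) (Sum.inl m) (Sum.inr q) = 0 := by
  have hind : IndepFun (fun ω => S.priorDir (pack (θ ω) (α ω)) (Pi.single (Sum.inl m) 1))
      (fun ω => S.priorDir (pack (θ ω) (α ω)) (Pi.single (Sum.inr q) 1)) P := by
    simp only [priorDir_inl, priorDir_inr, angles_pack, pack_inr]
    refine H.indep_angles_coeffs.comp
      (φ := fun t => fderiv ℝ S.prior t (Pi.single m 1) / S.prior t)
      (ψ := fun a => -(reim (a q.1) q.2 / S.sigmaAlpha q.1 ^ 2)) (H.measurable_angleScore _) ?_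
    exact (((measurable_reim q.2).comp (measurable_pi_apply q.1)).div_const _).neg
  rw [H.fimPrior_apply, hind.integral_fun_mul_eq_mul_integral (H.memLp_priorDir _).1
    (H.memLp_priorDir _).1, H.integral_priorDir, zero_mul]

theorem fimPrior_inr_inr_of_ne (H : S.IsModel P θ α N) {p q : Fin M × Fin 2} (hpq : p ≠ q) :
    S.fimPrior P (fun ω => pack (θ ω) (α ω)) (Sum.inr p) (Sum.inr q) = 0 := by
  rw [H.fimPrior_apply]
  have e : ∀ ω, S.priorDir (pack (θ ω) (α ω)) (Pi.single (Sum.inr p) 1) *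
      S.priorDir (pack (θ ω) (α ω)) (Pi.single (Sum.inr q) 1) =
      (S.sigmaAlpha p.1 ^ 2)⁻¹ * (S.sigmaAlpha q.1 ^ 2)⁻¹ *
        (reim (α ω p.1) p.2 * reim (α ω q.1) q.2) := fun ω => by
    rw [priorDir_inr, priorDir_inr, pack_inr, pack_inr]; ring
  simp only [e]
  rw [integral_const_mul, H.integral_coeff_reim_mul, if_neg hpq, mul_zero]

theorem fimPrior_isDiag (H : S.IsModel P θ α N) (hind : iIndepFun (fun m ω => θ ω m) P) :
    (S.fimPrior P (fun ω => pack (θ ω) (α ω))).IsDiag := by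
  have hsymm : ∀ i j, S.fimPrior P (fun ω => pack (θ ω) (α ω)) i j =
      S.fimPrior P (fun ω => pack (θ ω) (α ω)) j i := fun i j => by
    simp only [H.fimPrior_apply, mul_comm]
  rintro (m | p) (n | q) hij
  · exact H.fimPrior_inl_inl_of_ne hind fun h => hij (by rw [h])
  · exact H.fimPrior_inl_inr m q
  · rw [hsymm]
    exact H.fimPrior_inl_inr n p
  · exact H.fimPrior_inr_inr_of_ne fun h => hij (by rw [h])

theorem fim_inl_self (H : S.IsModel P θ α N) (m : Fin M) :
    S.fim P (fun ω => S.received (θ ω) (α ω) (N ω)) (fun ω => pack (θ ω) (α ω))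
      (Sum.inl m) (Sum.inl m) = S.beta m * (S.Amat P θ m * S.RX).trace.re +
        S.fimPrior P (fun ω => pack (θ ω) (α ω)) (Sum.inl m) (Sum.inl m) := by
  have h := congrArg Complex.re (H.fimObs_inl_self m)
  rw [Complex.ofReal_re, Complex.re_ofReal_mul] at h
  rw [H.fim_eq_add, Matrix.add_apply, h]

theorem isUnit_det_fim (H : S.IsModel P θ α N) :
    IsUnit (S.fim P (fun ω => S.received (θ ω) (α ω) (N ω))
      (fun ω => pack (θ ω) (α ω))).det :=
  isUnit_iff_ne_zero.2 H.fim_posDef.det_pos.ne'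

theorem mseMatrix_sub_inv_posSemidef (H : S.IsModel P θ α N)
    {g : Obs Nr L → ParamIdx M → ℝ} (hg : Measurable g)
    (hg2 : ∀ i, MemLp
      (fun ω => g (S.received (θ ω) (α ω) (N ω)) i - pack (θ ω) (α ω) i) 2 P) :
    (mseMatrix P g (fun ω => S.received (θ ω) (α ω) (N ω)) (fun ω => pack (θ ω) (α ω)) -
      (S.fim P (fun ω => S.received (θ ω) (α ω) (N ω))
        (fun ω => pack (θ ω) (α ω)))⁻¹).PosSemidef := by
  refine Matrix.PosSemidef.of_dotProduct_mulVec_nonneg ?_ fun x => ?_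
  · refine Matrix.IsHermitian.sub ?_ H.fim_posDef.1.inv
    ext i j
    simp only [Matrix.conjTranspose_apply, star_trivial, mseMatrix, Matrix.of_apply, mul_comm]
  · rw [star_trivial, Matrix.sub_mulVec, dotProduct_sub, sub_nonneg]
    have h1 := integral_sq_linear_combination hg2
      (F := mseMatrix P g (fun ω => S.received (θ ω) (α ω) (N ω)) (fun ω => pack (θ ω) (α ω)))
      (fun _ _ => rfl) x
    rw [← h1]
    -- The scalar error `∑ x_i e_i` has correlation `x_j` with the `j`-th score, because `E[e_i s_j]
    -- = δ_ij`.
    refine dotProduct_inv_mulVec_le_integral_sq H.isUnit_det_fim H.memLp_totalScore H.fim_apply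
      (memLp_linear_combination hg2 x) fun j => ?_
    have h2 := integral_mul_linear_combination (H.memLp_totalScore j) hg2 x
    simp only [mul_comm (totalScore S θ α N j _)] at h2
    rw [h2]
    have h3 : ∀ i, ∫ ω, (g (S.received (θ ω) (α ω) (N ω)) i - pack (θ ω) (α ω) i) *
        totalScore S θ α N j ω ∂P = (Pi.single i 1 : ParamIdx M → ℝ) j := fun i =>
      H.integral_error_mul_totalScore i j (g := fun y => g y i)
        ((measurable_pi_apply i).comp hg) (hg2 i)
    simp only [h3]
    rw [Finset.sum_eq_single j]
    · simp
    · intro i _ hi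
      simp [hi.symm]
    · simp

theorem aestronglyMeasurable_error (H : S.IsModel P θ α N) (i : ParamIdx M)
    {g : Obs Nr L → ℝ} (hg : Measurable g) :
    AEStronglyMeasurable
      (fun ω => g (S.received (θ ω) (α ω) (N ω)) - pack (θ ω) (α ω) i) P := by
  have h : Measurable fun z : (ParamIdx M → ℝ) × Obs Nr L => g z.2 - z.1 i :=
    (hg.comp measurable_snd).sub (by fun_prop)
  exact (h.comp_aemeasurable H.hasLaw_joint.aemeasurable).aestronglyMeasurable

theorem ofReal_inv_fim_le_lintegral (H : S.IsModel P θ α N) (i : ParamIdx M)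
    {g : Obs Nr L → ℝ} (hg : Measurable g) :
    ENNReal.ofReal ((S.fim P (fun ω => S.received (θ ω) (α ω) (N ω))
        (fun ω => pack (θ ω) (α ω)))⁻¹ i i) ≤
      ∫⁻ ω, ENNReal.ofReal
        ((g (S.received (θ ω) (α ω) (N ω)) - pack (θ ω) (α ω) i) ^ 2) ∂P := by
  refine ofReal_le_lintegral_sq (H.aestronglyMeasurable_error i hg) fun he => ?_
  have h := dotProduct_inv_mulVec_le_integral_sq H.isUnit_det_fim H.memLp_totalScore H.fim_apply he
    (H.integral_error_mul_totalScore i · hg he)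
  simpa using h

theorem ofReal_fim_inv_le_lintegral (H : S.IsModel P θ α N) (i : ParamIdx M)
    {g : Obs Nr L → ℝ} (hg : Measurable g) :
    ENNReal.ofReal (S.fim P (fun ω => S.received (θ ω) (α ω) (N ω))
        (fun ω => pack (θ ω) (α ω)) i i)⁻¹ ≤
      ∫⁻ ω, ENNReal.ofReal
        ((g (S.received (θ ω) (α ω) (N ω)) - pack (θ ω) (α ω) i) ^ 2) ∂P := by
  refine ofReal_le_lintegral_sq (H.aestronglyMeasurable_error i hg) fun he => ?_
  have hpos := H.fim_posDef.diag_pos (i := i)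
  rw [H.fim_apply] at hpos ⊢
  refine inv_le_integral_sq (H.memLp_totalScore i) he ?_ hpos
  simpa using H.integral_error_mul_totalScore i i hg he

end IsModel

end SensingSystem

/-! ### The main theorem -/

theorem mainTheorem2 {M Nt Nr L : ℕ} (S : SensingSystem M Nt Nr L)
    -- positive powers, differentiable steering vectors, differentiable prior density
    (hnoise : 0 < S.noiseVar) (hsigma : ∀ m, 0 < S.sigmaAlpha m)
    (ha : Differentiable ℝ S.a) (hb : Differentiable ℝ S.b)
    (hprior_nonneg : ∀ t, 0 ≤ S.prior t) (hprior_diff : Differentiable ℝ S.prior)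
    {Ω : Type*} [MeasurableSpace Ω] (P : Measure Ω) [IsProbabilityMeasure P]
    -- angles, reflection coefficients, noise: their laws and their independence
    (θ : Ω → Fin M → ℝ) (α : Ω → Fin M → ℂ) (N : Ω → Obs Nr L)
    (hθ : HasLaw θ (volume.withDensity fun t => ENNReal.ofReal (S.prior t)) P)
    (hα : HasLaw α (Measure.pi fun m => cscg (2 * S.sigmaAlpha m ^ 2)) P)
    (hN : HasLaw N (Measure.pi fun _ => Measure.pi fun _ => cscg S.noiseVar) P)
    (hθα : IndepFun θ α P) (hζN : IndepFun (fun ω => (θ ω, α ω)) N P)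
    -- the second moments in the Fisher information are finite
    (hresp : ∀ m i k, MemLp (fun ω => S.resp (θ ω m) i k) 2 P)
    (hrespDeriv : ∀ m i k, MemLp (fun ω => S.respDeriv (θ ω m) i k) 2 P)
    (hscore : ∀ m, Integrable
      (fun ω => (lineDeriv ℝ (fun t => Real.log (S.prior t)) (θ ω) (Pi.single m 1)) ^ 2) P)
    -- the parameter vector and the received signal
    (ζ : Ω → ParamIdx M → ℝ) (hζ : ∀ ω, ζ ω = SensingSystem.pack (θ ω) (α ω))
    (Y : Ω → Obs Nr L) (hY : ∀ ω, Y ω = S.received (θ ω) (α ω) (N ω)) :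
    -- the joint density of parameters and observation, and finiteness of the information
    HasLaw (fun ω => (ζ ω, Y ω))
      (volume.withDensity fun z : (ParamIdx M → ℝ) × Obs Nr L =>
        ENNReal.ofReal (S.condPDF z.2 z.1 * S.paramPDF z.1)) P ∧
    (∀ i, MemLp (fun ω => S.obsScore i (Y ω) (ζ ω)) 2 P) ∧
    (∀ i, MemLp (fun ω => S.priorScore i (ζ ω)) 2 P) ∧
    -- the Bayesian Fisher information matrix
    S.fim P Y ζ = S.fimObs P Y ζ + S.fimPrior P ζ ∧
    (S.fim P Y ζ).PosDef ∧
    (∀ m n, m ≠ n → S.fimObs P Y ζ (Sum.inl m) (Sum.inl n) = 0) ∧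
    (∀ m, (S.fimObs P Y ζ (Sum.inl m) (Sum.inl m) : ℂ) =
      (S.beta m : ℂ) * (S.Amat P θ m * S.RX).trace) ∧
    (∀ m q, S.fimObs P Y ζ (Sum.inl m) (Sum.inr q) = 0) ∧
    -- the Bayesian information inequality for estimators of all parameters
    (∀ g : Obs Nr L → ParamIdx M → ℝ, Measurable g →
      (∀ i, MemLp (fun ω => g (Y ω) i - ζ ω i) 2 P) →
      (SensingSystem.mseMatrix P g Y ζ - (S.fim P Y ζ)⁻¹).PosSemidef) ∧
    -- bounds on the MSE of an arbitrary estimator of one angle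
    (∀ m, ∀ g : Obs Nr L → ℝ, Measurable g →
      ENNReal.ofReal ((S.fim P Y ζ)⁻¹ (Sum.inl m) (Sum.inl m)) ≤
        ∫⁻ ω, ENNReal.ofReal ((g (Y ω) - θ ω m) ^ 2) ∂P) ∧
    (∀ m, 0 < S.beta m * (S.Amat P θ m * S.RX).trace.re +
        S.fimPrior P ζ (Sum.inl m) (Sum.inl m) ∧
      ∀ g : Obs Nr L → ℝ, Measurable g →
        ENNReal.ofReal ((S.beta m * (S.Amat P θ m * S.RX).trace.re +
          S.fimPrior P ζ (Sum.inl m) (Sum.inl m))⁻¹) ≤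
            ∫⁻ ω, ENNReal.ofReal ((g (Y ω) - θ ω m) ^ 2) ∂P) ∧
    -- with independent angles, the closed form is the diagonal entry of the inverse
    (iIndepFun (fun m ω => θ ω m) P →
      (S.fimPrior P ζ).IsDiag ∧
      ∀ m, (S.fim P Y ζ)⁻¹ (Sum.inl m) (Sum.inl m) =
        (S.beta m * (S.Amat P θ m * S.RX).trace.re +
          S.fimPrior P ζ (Sum.inl m) (Sum.inl m))⁻¹) := by
  obtain rfl : ζ = fun ω => SensingSystem.pack (θ ω) (α ω) := funext hζ
  obtain rfl : Y = fun ω => S.received (θ ω) (α ω) (N ω) := funext hY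
  have H : S.IsModel P θ α N :=
    ⟨inferInstance, hnoise, hsigma, ha, hb, hprior_nonneg, hprior_diff, hθ, hα, hN, hθα, hζN,
      hresp, hrespDeriv, hscore⟩
  refine ⟨H.hasLaw_joint, fun i => ?_, fun i => (H.memLp_priorDir i).ae_eq
    (H.priorScore_ae_eq i).symm, H.fim_eq_add, H.fim_posDef,
    fun m n hmn => H.fimObs_inl_inl_of_ne hmn, H.fimObs_inl_self, H.fimObs_inl_inr,
    fun g hg hg2 => H.mseMatrix_sub_inv_posSemidef hg hg2,
    fun m g hg => H.ofReal_inv_fim_le_lintegral (Sum.inl m) hg, fun m => ?_,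
    fun hind => ⟨H.fimPrior_isDiag hind, fun m => ?_⟩⟩
  · simp only [S.obsScore_eq hnoise ha hb]
    exact H.memLp_obsDir _
  · rw [← H.fim_inl_self m]
    exact ⟨H.fim_posDef.diag_pos, fun g hg => H.ofReal_fim_inv_le_lintegral (Sum.inl m) hg⟩
  · rw [← H.fim_inl_self m]
    -- Only the row of `θ_m` has to be zero off the diagonal; the `α`-`α` block of `F_O` may be
    -- full.
    refine Matrix.inv_apply_self_of_row_eq_zero H.isUnit_det_fim ?_
    rintro (n | q) hj
    · have hmn : m ≠ n := fun h => hj (by rw [h])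
      rw [H.fim_eq_add, Matrix.add_apply, H.fimObs_inl_inl_of_ne hmn,
        H.fimPrior_inl_inl_of_ne hind hmn, add_zero]
    · rw [H.fim_eq_add, Matrix.add_apply, H.fimObs_inl_inr, H.fimPrior_inl_inr, add_zero]
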